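/- Let $d \ge 1$, $N \ge 0$ and $\sigma > 0$. There is a constant $C$, depending only on $d$, $N$ and $\sigma$, such that the following holds. Let $D \subset \mathbb{R}^d$ be an affine simplicial element, that is, $D = \Phi(\widehat D)$ for an invertible affine map $\Phi$ of $\mathbb{R}^d$, where $\widehat D = \{x : x_i > -1 \text{ for all } i,\ \sum_i x_i < 2-d\}$ is the bi-unit reference simplex (a triangle for $d=2$, a tetrahedron for $d=3$). Let $h = \operatorname{diam}(D)$, and suppose that $D$ is quasi-regular with constant $\sigma$: $D$ contains a ball whose diameter $\rho$ satisfies $h \le \sigma\rho$. Let $w \in W^{N+1,\infty}(D)$ satisfy $w \ge w_{\min}$ almost everywhere in $D$ for some constant $w_{\min} > 0$, and let $u \in W^{N+1,2}(D)$. Then $$\|uw - T_w u\|_{L^2(D)} \le C_w h^{N+1} \|u\|_{W^{N+1,2}(D)}, \qquad \|uw - T_{1/w}^{-1} u\|_{L^2(D)} \le C_w h^{N+1} \|u\|_{W^{N+1,2}(D)},$$ where $$C_w = C\, \|w\|_{L^\infty(D)} \Big\|\frac1w\Big\|_{L^\infty(D)} \|w\|_{W^{N+1,\infty}(D)}.$$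 Here $P^N$ is the space of polynomials on $\mathbb{R}^d$ of total degree at most $N$, $\Pi_N$ is the $L^2(D)$-orthogonal projection onto $P^N$, $T_w u = \Pi_N(wu)$, and $T_{1/w}^{-1}u \in P^N$ is defined by $\int_D \frac1w\,(T_{1/w}^{-1}u)\, v = \int_D u v$ for all $v \in P^N$. The Sobolev norms are $\|u\|_{W^{s,2}(D)} = \big(\sum_{|\alpha|\le s} \|D^\alpha u\|_{L^2(D)}^2\big)^{1/2}$ and $\|w\|_{W^{s,\infty}(D)} = \max_{|\alpha|\le s}\|D^\alpha w\|_{L^\infty(D)}$, with weak derivatives $D^\alpha$. -/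

import Mathlib

open MeasureTheory
open scoped ENNReal NNReal

noncomputable section

namespace WADG

/-- `d`-dimensional Euclidean space. -/
abbrev E (d : ℕ) : Type := EuclideanSpace ℝ (Fin d)

/-! ### Weak derivatives and Sobolev spaces -/

/-- The classical partial derivative `∂f/∂xᵢ`. -/
def partialDeriv {d : ℕ} (i : Fin d) (f : E d → ℝ) : E d → ℝ :=
  fun x => fderiv ℝ f x (EuclideanSpace.single i 1)

/-- The classical derivative `∂₁^{α₁} ⋯ ∂_d^{α_d} f` for a multi-index `α`. -/
def multiDeriv {d : ℕ} (α : Fin d → ℕ) (f : E d → ℝ) : E d → ℝ :=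
  (List.finRange d).foldr (fun i g => (partialDeriv i)^[α i] g) f

/-- The order `|α|` of a multi-index. -/
def order {d : ℕ} (α : Fin d → ℕ) : ℕ := ∑ i, α i

/-- The finite set of multi-indices with `|α| ≤ s`. -/
def multiIndices (d s : ℕ) : Finset (Fin d → ℕ) :=
  (Fintype.piFinset fun _ => Finset.range (s + 1)).filter fun α => order α ≤ s

theorem mem_multiIndices {d s : ℕ} (α : Fin d → ℕ) :
    α ∈ multiIndices d s ↔ order α ≤ s := by
  simp only [multiIndices, Finset.mem_filter, Fintype.mem_piFinset, Finset.mem_range,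
    and_iff_right_iff_imp]
  intro h i
  have : α i ≤ order α := Finset.single_le_sum (fun _ _ => Nat.zero_le _) (Finset.mem_univ i)
  omega

/-- `g` is a weak derivative `D^α u` on the open set `Ω`. -/
def HasWeakDeriv {d : ℕ} (Ω : Set (E d)) (α : Fin d → ℕ) (u g : E d → ℝ) : Prop :=
  LocallyIntegrableOn u Ω ∧ LocallyIntegrableOn g Ω ∧
    ∀ φ : E d → ℝ, ContDiff ℝ (⊤ : ℕ∞) φ → HasCompactSupport φ → tsupport φ ⊆ Ω →
      ∫ x in Ω, u x * multiDeriv α φ x = (-1) ^ order α * ∫ x in Ω, g x * φ x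

/-- The Sobolev space `W^{s,p}(Ω)`. -/
def MemSobolev {d : ℕ} (Ω : Set (E d)) (s : ℕ) (p : ℝ≥0∞) (u : E d → ℝ) : Prop :=
  MemLp u p (volume.restrict Ω) ∧
    ∀ α : Fin d → ℕ, order α ≤ s →
      ∃ g : E d → ℝ, HasWeakDeriv Ω α u g ∧ MemLp g p (volume.restrict Ω)

open Classical in
/-- The weak derivative `D^α u` on `Ω`, unique up to null sets (and `0` if there is none). -/
def weakDeriv {d : ℕ} (Ω : Set (E d)) (α : Fin d → ℕ) (u : E d → ℝ) : E d → ℝ :=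
  if h : ∃ g, HasWeakDeriv Ω α u g then h.choose else 0

/-- The Sobolev norm of `u ∈ W^{s,p}(Ω)`: the `ℓ^p` norm (the maximum if `p = ∞`) of the family
`‖D^α u‖_{L^p(Ω)}`, `|α| ≤ s`. -/
def sobolevNorm {d : ℕ} (Ω : Set (E d)) (s : ℕ) (p : ℝ≥0∞) (u : E d → ℝ) : ℝ≥0∞ :=
  if p = ∞ then
    (multiIndices d s).sup fun α => eLpNorm (weakDeriv Ω α u) ∞ (volume.restrict Ω)
  else
    (∑ α ∈ multiIndices d s,
      eLpNorm (weakDeriv Ω α u) p (volume.restrict Ω) ^ p.toReal) ^ (1 / p.toReal)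

/-! ### Affine elements -/

/-- The (open) bi-unit reference simplex, with vertices `(-1, …, -1)` and
`(-1, …, -1) + 2 eᵢ`. For `d = 2` it is `{x, y > -1, x + y < 0}`. -/
def refSimplex (d : ℕ) : Set (E d) :=
  {x | (∀ i, -1 < x i) ∧ ∑ i, x i < 2 - (d : ℝ)}

/-- An affine element: the image of the reference simplex under an affine elemental mapping. -/
def IsAffineElement {d : ℕ} (D : Set (E d)) : Prop :=
  ∃ Φ : E d ≃ᵃ[ℝ] E d, D = Φ '' refSimplex d

/-- Quasi-regularity with constant `σ`: the diameter of `D` is at most `σ` times the diameter `2r`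
of some ball inscribed in `D`. -/
def IsQuasiRegular {d : ℕ} (σ : ℝ) (D : Set (E d)) : Prop :=
  ∃ (c : E d) (r : ℝ), 0 < r ∧ Metric.ball c r ⊆ D ∧ Metric.diam D ≤ σ * (2 * r)

/-! ### Polynomials and the operators `Π_N`, `T_w`, `T_w⁻¹` -/

/-- Evaluation of polynomials as functions on Euclidean space. -/
def polyEval (d : ℕ) : MvPolynomial (Fin d) ℝ →ₗ[ℝ] (E d → ℝ) where
  toFun p := fun x => MvPolynomial.eval (fun i => x i) p
  map_add' p q := by ext x; simp
  map_smul' c p := by ext x; simp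

/-- The space `P^N` of polynomial functions of total degree at most `N`. -/
def polySpace (d N : ℕ) : Submodule ℝ (E d → ℝ) :=
  (MvPolynomial.restrictTotalDegree (Fin d) ℝ N).map (polyEval d)

/-- `q ∈ P^N` and `(w q, v)_{L²(D)} = (f, v)_{L²(D)}` for all `v ∈ P^N`. -/
def IsWeightedProj {d : ℕ} (D : Set (E d)) (N : ℕ) (w f q : E d → ℝ) : Prop :=
  q ∈ polySpace d N ∧
    ∀ v ∈ polySpace d N, ∫ x in D, w x * q x * v x = ∫ x in D, f x * v x

theorem analyticOnNhd_of_mem_polySpace {d N : ℕ} {q : E d → ℝ} (hq : q ∈ polySpace d N) :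
    AnalyticOnNhd ℝ q Set.univ := by
  obtain ⟨p, -, rfl⟩ := hq
  have h := AnalyticOnNhd.aeval_mvPolynomial (𝕜 := ℝ) (s := (Set.univ : Set (E d)))
    (f := fun (x : E d) (i : Fin d) => x i)
    (fun i => (EuclideanSpace.proj i : E d →L[ℝ] ℝ).analyticOnNhd _) p
  simpa [polyEval, MvPolynomial.coe_aeval_eq_eval] using h

/-- Well-posedness of the problem that defines `T_w⁻¹` and `Π_N`, for a bounded weight `w` that is
bounded below by a positive constant. -/
theorem existsUnique_isWeightedProj {d : ℕ} {D : Set (E d)} (hDo : IsOpen D) (hDn : D.Nonempty)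
    (hDb : Bornology.IsBounded D) (N : ℕ) {w f : E d → ℝ} (hw : MemLp w ⊤ (volume.restrict D))
    {a : ℝ} (ha : 0 < a) (haw : ∀ᵐ x ∂(volume.restrict D), a ≤ w x)
    (hf : MemLp f 2 (volume.restrict D)) : ∃! q, IsWeightedProj D N w f q := by
  have hcont : ∀ q ∈ polySpace d N, Continuous q := fun q hq =>
    continuousOn_univ.1 (analyticOnNhd_of_mem_polySpace hq).continuousOn
  have hint : ∀ g : E d → ℝ, Continuous g → Integrable g (volume.restrict D) := fun g hg =>
    (hg.continuousOn.integrableOn_compact hDb.isCompact_closure).mono_set subset_closure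
  have hwint : ∀ g : E d → ℝ, Continuous g → Integrable (fun x => w x * g x)
      (volume.restrict D) := fun g hg => (hint g hg).mul_of_top_right hw
  have hfint : ∀ g : E d → ℝ, Continuous g → Integrable (fun x => f x * g x)
      (volume.restrict D) := fun g hg => hf.integrable_mul
        ((memLp_two_iff_integrable_sq hg.aestronglyMeasurable).2 (hint _ (hg.pow 2)))
  let V := polySpace d N
  have : FiniteDimensional ℝ V := inferInstanceAs (FiniteDimensional ℝ
    ((MvPolynomial.restrictTotalDegree (Fin d) ℝ N).map (polyEval d)))
  have hI : ∀ q v : V, Integrable (fun x => w x * q.1 x * v.1 x) (volume.restrict D) := by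
    intro q v
    simpa [mul_assoc] using hwint _ ((hcont _ q.2).mul (hcont _ v.2))
  let B : V →ₗ[ℝ] V →ₗ[ℝ] ℝ := LinearMap.mk₂ ℝ (fun q v => ∫ x in D, w x * q.1 x * v.1 x)
    (fun q r v => by
      rw [← integral_add (hI q v) (hI r v)]
      congr 1; ext x; simp; ring)
    (fun c q v => by
      rw [smul_eq_mul, ← integral_const_mul]
      congr 1; ext x; simp; ring)
    (fun q v r => by
      rw [← integral_add (hI q v) (hI q r)]
      congr 1; ext x; simp; ring)
    (fun c q v => by
      rw [smul_eq_mul, ← integral_const_mul]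
      congr 1; ext x; simp; ring)
  have hB : ∀ q v, B q v = ∫ x in D, w x * q.1 x * v.1 x := fun q v => rfl
  have hinj : Function.Injective B := by
    rw [← LinearMap.ker_eq_bot, LinearMap.ker_eq_bot']
    intro q hq
    have h0 : ∫ x in D, w x * q.1 x * q.1 x = 0 := by rw [← hB, hq]; simp
    have hnn : 0 ≤ᵐ[volume.restrict D] fun x => w x * q.1 x * q.1 x := by
      filter_upwards [haw] with x hx
      have := mul_nonneg (ha.le.trans hx) (mul_self_nonneg (q.1 x))
      simpa [mul_assoc] using this
    have hae : q.1 =ᵐ[volume.restrict D] 0 := by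
      filter_upwards [(integral_eq_zero_iff_of_nonneg_ae hnn (hI q q)).1 h0, haw] with x hx hax
      have hwx : w x ≠ 0 := (ha.trans_le hax).ne'
      simpa [hwx] using hx
    have hon : Set.EqOn q.1 0 D := Measure.eqOn_open_of_ae_eq hae hDo
      (hcont _ q.2).continuousOn continuousOn_const
    obtain ⟨x₀, hx₀⟩ := hDn
    have := (analyticOnNhd_of_mem_polySpace q.2).eqOn_zero_of_preconnected_of_eventuallyEq_zero
      isPreconnected_univ (Set.mem_univ x₀)
      (Filter.eventuallyEq_of_mem (hDo.mem_nhds hx₀) hon)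
    ext x
    simpa using this (Set.mem_univ x)
  have hsurj : Function.Surjective B :=
    (LinearMap.injective_iff_surjective_of_finrank_eq_finrank
      (Subspace.dual_finrank_eq (K := ℝ) (V := V)).symm).1 hinj
  let F : V →ₗ[ℝ] ℝ :=
    { toFun := fun v => ∫ x in D, f x * v.1 x
      map_add' := fun v r => by
        rw [← integral_add (hfint _ (hcont _ v.2)) (hfint _ (hcont _ r.2))]
        congr 1; ext x; simp; ring
      map_smul' := fun c v => by
        rw [RingHom.id_apply, smul_eq_mul, ← integral_const_mul]
        congr 1; ext x; simp; ring }
  obtain ⟨q, hq⟩ := hsurj F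
  refine ⟨q.1, ⟨q.2, fun v hv => ?_⟩, ?_⟩
  · exact LinearMap.congr_fun hq ⟨v, hv⟩
  · rintro r ⟨hr, hr'⟩
    have : B ⟨r, hr⟩ = B q := by
      rw [hq]
      ext v
      exact hr' v.1 v.2
    exact congrArg Subtype.val (hinj this)

open Classical in
/-- The operator `T_w⁻¹ : L²(D) → P^N(D)`, defined by `(w T_w⁻¹ f, v) = (f, v)` for all
`v ∈ P^N`; the solution exists and is unique by `existsUnique_isWeightedProj`. -/
def TInv {d : ℕ} (D : Set (E d)) (N : ℕ) (w f : E d → ℝ) : E d → ℝ :=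
  if h : ∃ q, IsWeightedProj D N w f q then h.choose else 0

/-- The `L²(D)`-projection onto `P^N`: `(Π_N f, v) = (f, v)` for all `v ∈ P^N`. -/
def PiN {d : ℕ} (D : Set (E d)) (N : ℕ) (f : E d → ℝ) : E d → ℝ :=
  TInv D N (fun _ => 1) f

/-- The operator `T_w f = Π_N (w f)`. -/
def T {d : ℕ} (D : Set (E d)) (N : ℕ) (w f : E d → ℝ) : E d → ℝ :=
  PiN D N (fun x => w x * f x)

end WADG

end

/-! Both operators are weighted `L²` projections of the same function `g = u w`. `T` has weight `1`
and right-hand side `w u`; `TInv` with weight `1/w` has right-hand side `u = (1/w) g`. For a weight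
between `m` and `M`, the error `g - q` is orthogonal to `P^N` in the weighted inner product, so `m
‖g - q‖² ≤ M ‖g - p‖²` for every `p ∈ P^N` (`IsWeightedProj.eLpNorm_sub_sq_le`). The ratio `M / m`
is `1` in the first case and `‖w‖_∞ ‖1/w‖_∞` in the second. The latter number is at least `1`, hence
it dominates its own square root.

It remains to find one polynomial close to `u w`. The Leibniz rule
(`IsDerivFamily.exists_hasWeakDeriv_mul`) bounds the weak derivatives of `u w` by the Sobolev norms
of `u` and `w`, and the Bramble–Hilbert lemma (`exists_mem_polySpace_eLpNorm_sub_le`) turns this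
into an error of order `h^(N+1)`. The latter iterates a Poincaré inequality
(`exists_eLpNorm_sub_const_le`), which comes from integrating `|f x - f y|²` over `D × D` along
segments. This uses only that `D` is open, convex, bounded and nonempty; there is no pull-back to
the reference simplex, and the constant depends only on `d` and `N`. Mollification reduces both the
Leibniz rule and the Poincaré inequality to smooth functions. -/

namespace WADG

variable {d : ℕ}

/-! ### Calculus of multi-index derivatives -/

/-- Smooth functions with compact support in `Ω`. -/
structure IsTest (Ω : Set (E d)) (φ : E d → ℝ) : Prop where
  contDiff : ContDiff ℝ (⊤ : ℕ∞) φ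
  hasCompactSupport : HasCompactSupport φ
  tsupport_subset : tsupport φ ⊆ Ω

theorem contDiff_partialDeriv (i : Fin d) {f : E d → ℝ} (hf : ContDiff ℝ (⊤ : ℕ∞) f) :
    ContDiff ℝ (⊤ : ℕ∞) (partialDeriv i f) :=
  (hf.fderiv_right (m := (⊤ : ℕ∞)) (by simp)).clm_apply contDiff_const

theorem partialDeriv_comm (i j : Fin d) {f : E d → ℝ} (hf : ContDiff ℝ (⊤ : ℕ∞) f) :
    partialDeriv i (partialDeriv j f) = partialDeriv j (partialDeriv i f) := by
  have hd : Differentiable ℝ (fderiv ℝ f) :=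
    (hf.fderiv_right (m := (⊤ : ℕ∞)) (by simp)).differentiable (by simp)
  have key : ∀ (k l : Fin d) (x : E d), partialDeriv k (partialDeriv l f) x =
      fderiv ℝ (fderiv ℝ f) x (EuclideanSpace.single k 1) (EuclideanSpace.single l 1) := by
    intro k l x
    change fderiv ℝ (fun y => fderiv ℝ f y (EuclideanSpace.single l 1)) x _ = _
    rw [fderiv_clm_apply (hd x) (differentiableAt_const _)]
    simp
  ext x
  rw [key, key]
  exact (hf.contDiffAt.isSymmSndFDerivAt (by
    rw [minSmoothness_of_isRCLikeNormedField]
    exact WithTop.coe_le_coe.2 (le_top : (2 : ℕ∞) ≤ ⊤))).eq _ _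

theorem contDiff_iterate_partialDeriv (i : Fin d) (n : ℕ) {f : E d → ℝ}
    (hf : ContDiff ℝ (⊤ : ℕ∞) f) : ContDiff ℝ (⊤ : ℕ∞) ((partialDeriv i)^[n] f) := by
  induction n with
  | zero => exact hf
  | succ n ih => rw [Function.iterate_succ_apply']; exact contDiff_partialDeriv i ih

theorem iterate_partialDeriv_comm (i j : Fin d) (n : ℕ) {f : E d → ℝ}
    (hf : ContDiff ℝ (⊤ : ℕ∞) f) :
    (partialDeriv j)^[n] (partialDeriv i f) = partialDeriv i ((partialDeriv j)^[n] f) := by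
  induction n with
  | zero => rfl
  | succ n ih =>
    rw [Function.iterate_succ_apply', ih, Function.iterate_succ_apply',
      partialDeriv_comm j i (contDiff_iterate_partialDeriv j n hf)]

theorem contDiff_foldr_partialDeriv (l : List (Fin d)) (α : Fin d → ℕ) {f : E d → ℝ}
    (hf : ContDiff ℝ (⊤ : ℕ∞) f) :
    ContDiff ℝ (⊤ : ℕ∞) (l.foldr (fun i g => (partialDeriv i)^[α i] g) f) := by
  induction l with
  | nil => exact hf
  | cons j l ih => exact contDiff_iterate_partialDeriv j _ ih

theorem foldr_partialDeriv_comm (l : List (Fin d)) (α : Fin d → ℕ) (i : Fin d) {f : E d → ℝ}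
    (hf : ContDiff ℝ (⊤ : ℕ∞) f) :
    l.foldr (fun i g => (partialDeriv i)^[α i] g) (partialDeriv i f) =
      partialDeriv i (l.foldr (fun i g => (partialDeriv i)^[α i] g) f) := by
  induction l with
  | nil => rfl
  | cons j l ih =>
    rw [List.foldr_cons, ih, List.foldr_cons,
      iterate_partialDeriv_comm i j _ (contDiff_foldr_partialDeriv l α hf)]

theorem foldr_add_single_of_notMem {l : List (Fin d)} (α : Fin d → ℕ) {i : Fin d} (hi : i ∉ l)
    (f : E d → ℝ) :
    l.foldr (fun j g => (partialDeriv j)^[(α + Pi.single i 1 : Fin d → ℕ) j] g) f =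
      l.foldr (fun j g => (partialDeriv j)^[α j] g) f := by
  induction l with
  | nil => rfl
  | cons j l ih =>
    simp only [List.mem_cons, not_or] at hi
    rw [List.foldr_cons, ih hi.2, List.foldr_cons]
    simp [Ne.symm hi.1]

/-- The extra derivative enters at the unique position of `i` in the list; by symmetry of second
derivatives it can be moved past the operators applied after it. -/
theorem foldr_add_single {l : List (Fin d)} (hl : l.Nodup) (α : Fin d → ℕ) {i : Fin d}
    (hi : i ∈ l) {f : E d → ℝ} (hf : ContDiff ℝ (⊤ : ℕ∞) f) :
    l.foldr (fun j g => (partialDeriv j)^[(α + Pi.single i 1 : Fin d → ℕ) j] g) f =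
      partialDeriv i (l.foldr (fun j g => (partialDeriv j)^[α j] g) f) := by
  induction l with
  | nil => simp at hi
  | cons j l ih =>
    rw [List.nodup_cons] at hl
    rw [List.foldr_cons, List.foldr_cons]
    rcases eq_or_ne i j with rfl | hij
    · rw [foldr_add_single_of_notMem α hl.1]
      simp [Function.iterate_succ_apply']
    · rw [ih hl.2 ((List.mem_cons.1 hi).resolve_left hij),
        iterate_partialDeriv_comm i j _ (contDiff_foldr_partialDeriv l α hf)]
      simp [Ne.symm hij]

theorem multiDeriv_add_single (α : Fin d → ℕ) (i : Fin d) {f : E d → ℝ}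
    (hf : ContDiff ℝ (⊤ : ℕ∞) f) :
    multiDeriv (α + Pi.single i 1) f = partialDeriv i (multiDeriv α f) :=
  foldr_add_single (List.nodup_finRange d) α (List.mem_finRange i) hf

theorem multiDeriv_partialDeriv (α : Fin d → ℕ) (i : Fin d) {f : E d → ℝ}
    (hf : ContDiff ℝ (⊤ : ℕ∞) f) :
    multiDeriv α (partialDeriv i f) = partialDeriv i (multiDeriv α f) :=
  foldr_partialDeriv_comm _ α i hf

@[simp]
theorem multiDeriv_zero (f : E d → ℝ) : multiDeriv 0 f = f := by
  unfold multiDeriv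
  induction List.finRange d with
  | nil => rfl
  | cons j l ih => rw [List.foldr_cons, ih]; rfl

theorem multiDeriv_single (i : Fin d) {f : E d → ℝ} (hf : ContDiff ℝ (⊤ : ℕ∞) f) :
    multiDeriv (Pi.single i 1) f = partialDeriv i f := by
  simpa using multiDeriv_add_single 0 i hf

@[simp]
theorem order_zero : order (0 : Fin d → ℕ) = 0 := by simp [order]

theorem order_add (α β : Fin d → ℕ) : order (α + β) = order α + order β := by
  simp [order, Finset.sum_add_distrib]

@[simp]
theorem order_single (i : Fin d) : order (Pi.single i 1 : Fin d → ℕ) = 1 := by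
  simp [order]

theorem exists_eq_add_single {α : Fin d → ℕ} {n : ℕ} (h : order α = n + 1) :
    ∃ (β : Fin d → ℕ) (i : Fin d), order β = n ∧ α = β + Pi.single i 1 := by
  obtain ⟨i, -, hi⟩ : ∃ i ∈ Finset.univ, α i ≠ 0 := by
    apply Finset.exists_ne_zero_of_sum_ne_zero
    change order α ≠ 0
    omega
  have hα : α = (α - Pi.single i 1) + Pi.single i 1 := by
    ext j
    rcases eq_or_ne j i with rfl | hj
    · simp; omega
    · simp [hj]
  refine ⟨α - Pi.single i 1, i, ?_, hα⟩
  have := congrArg order hα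
  rw [order_add, order_single] at this
  omega

@[elab_as_elim]
theorem multiIndex_induction {P : (Fin d → ℕ) → Prop} (h0 : P 0)
    (hs : ∀ α i, P α → P (α + Pi.single i 1)) (α : Fin d → ℕ) : P α := by
  obtain ⟨n, hn⟩ : ∃ n, order α = n := ⟨_, rfl⟩
  induction n generalizing α with
  | zero =>
    have : α = 0 := by
      ext i
      exact (Finset.sum_eq_zero_iff.1 hn) i (Finset.mem_univ i)
    rwa [this]
  | succ n ih =>
    obtain ⟨β, i, hβ, rfl⟩ := exists_eq_add_single hn
    exact hs β i (ih β hβ)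

variable {Ω : Set (E d)}

theorem tsupport_partialDeriv_subset (i : Fin d) (φ : E d → ℝ) :
    tsupport (partialDeriv i φ) ⊆ tsupport φ :=
  tsupport_fderiv_apply_subset ℝ _

theorem IsTest.partialDeriv {φ : E d → ℝ} (h : IsTest Ω φ) (i : Fin d) :
    IsTest Ω (partialDeriv i φ) :=
  ⟨contDiff_partialDeriv i h.contDiff,
    h.hasCompactSupport.fderiv_apply ℝ _,
    (tsupport_partialDeriv_subset i φ).trans h.tsupport_subset⟩

theorem IsTest.multiDeriv {φ : E d → ℝ} (h : IsTest Ω φ) (α : Fin d → ℕ) :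
    IsTest Ω (multiDeriv α φ) := by
  induction α using multiIndex_induction with
  | h0 => simpa using h
  | hs α i ih => rw [multiDeriv_add_single α i h.contDiff]; exact ih.partialDeriv i

/-! ### Calculus of weak derivatives -/

theorem hasWeakDeriv_iff (α : Fin d → ℕ) (u g : E d → ℝ) : HasWeakDeriv Ω α u g ↔
    LocallyIntegrableOn u Ω ∧ LocallyIntegrableOn g Ω ∧ ∀ φ, IsTest Ω φ →
      ∫ x in Ω, u x * multiDeriv α φ x = (-1) ^ order α * ∫ x in Ω, g x * φ x :=
  ⟨fun h => ⟨h.1, h.2.1, fun φ hφ => h.2.2 φ hφ.1 hφ.2 hφ.3⟩,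
    fun h => ⟨h.1, h.2.1, fun φ h1 h2 h3 => h.2.2 φ ⟨h1, h2, h3⟩⟩⟩

theorem hasWeakDeriv_single_iff (i : Fin d) (u g : E d → ℝ) :
    HasWeakDeriv Ω (Pi.single i 1) u g ↔
    LocallyIntegrableOn u Ω ∧ LocallyIntegrableOn g Ω ∧ ∀ φ, IsTest Ω φ →
      ∫ x in Ω, u x * partialDeriv i φ x = - ∫ x in Ω, g x * φ x := by
  rw [hasWeakDeriv_iff]
  refine and_congr_right fun _ => and_congr_right fun _ => forall₂_congr fun φ hφ => ?_
  rw [multiDeriv_single i hφ.contDiff]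
  simp

theorem HasWeakDeriv.test {α : Fin d → ℕ} {u g φ : E d → ℝ} (h : HasWeakDeriv Ω α u g)
    (hφ : IsTest Ω φ) :
    ∫ x in Ω, u x * multiDeriv α φ x = (-1) ^ order α * ∫ x in Ω, g x * φ x :=
  h.2.2 φ hφ.1 hφ.2 hφ.3

theorem hasWeakDeriv_zero {u : E d → ℝ} (hu : LocallyIntegrableOn u Ω) :
    HasWeakDeriv Ω 0 u u :=
  ⟨hu, hu, by simp⟩

theorem IsTest.integrable_mul {u φ : E d → ℝ} (hu : LocallyIntegrableOn u Ω)
    (hφ : IsTest Ω φ) : Integrable (fun x => u x * φ x) (volume.restrict Ω) := by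
  have h1 : IntegrableOn u (tsupport φ) := hu.integrableOn_compact_subset hφ.tsupport_subset
    hφ.hasCompactSupport
  obtain ⟨C, hC⟩ := hφ.hasCompactSupport.exists_bound_of_continuous hφ.contDiff.continuous
  have h2 : IntegrableOn (fun x => u x * φ x) (tsupport φ) :=
    h1.mul_bdd (c := C) hφ.contDiff.continuous.aestronglyMeasurable (.of_forall hC)
  have h3 : Integrable (fun x => u x * φ x) :=
    (integrableOn_iff_integrable_of_support_subset (fun x hx => by
      apply subset_tsupport φ
      intro h
      exact hx (by simp [h]))).1 h2
  exact h3.restrict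

/-- The fundamental lemma of the calculus of variations, applied to `g - g'`. It lets the arbitrary
choice inside `weakDeriv` be exchanged for any other weak derivative. -/
theorem HasWeakDeriv.ae_eq (hΩ : IsOpen Ω) {α : Fin d → ℕ} {u g g' : E d → ℝ}
    (h : HasWeakDeriv Ω α u g) (h' : HasWeakDeriv Ω α u g') :
    g =ᵐ[volume.restrict Ω] g' := by
  rw [Filter.EventuallyEq, ae_restrict_iff' hΩ.measurableSet]
  have := hΩ.ae_eq_zero_of_integral_contDiff_smul_eq_zero (μ := volume)
    (f := fun x => g x - g' x) (h.2.1.sub h'.2.1) ?_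
  · filter_upwards [this] with x hx hxΩ using sub_eq_zero.1 (hx hxΩ)
  · intro φ h1 h2 h3
    have hφ : IsTest Ω φ := ⟨h1, h2, h3⟩
    have e := (h.test hφ).symm.trans (h'.test hφ)
    have e' := mul_left_cancel₀ (pow_ne_zero _ (by norm_num)) e
    rw [← setIntegral_eq_integral_of_forall_compl_eq_zero (s := Ω)]
    · calc ∫ x in Ω, φ x • (g x - g' x) = ∫ x in Ω, (g x * φ x - g' x * φ x) := by
            congr 1; ext x; simp; ring
        _ = 0 := by
            rw [integral_sub (hφ.integrable_mul h.2.1) (hφ.integrable_mul h'.2.1), e',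
              sub_self]
    · intro x hx
      have : φ x = 0 := image_eq_zero_of_notMem_tsupport fun hxs => hx (h3 hxs)
      simp [this]

/-- `∂ᵢ` of `D^α u` is `D^{α + eᵢ} u`. -/
theorem HasWeakDeriv.single_of_add {α : Fin d → ℕ} {i : Fin d} {u g g' : E d → ℝ}
    (h : HasWeakDeriv Ω α u g) (h' : HasWeakDeriv Ω (α + Pi.single i 1) u g') :
    HasWeakDeriv Ω (Pi.single i 1) g g' := by
  rw [hasWeakDeriv_single_iff]
  refine ⟨h.2.1, h'.2.1, fun φ hφ => ?_⟩
  -- Testing `g = D^α u` with `∂ᵢ φ` and `g'` with `φ` produces the same integral of `u`, because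
  -- `∂ᵢ` and `D^α` commute on smooth functions.
  have e := h.test (hφ.partialDeriv i)
  have e' := h'.test hφ
  rw [multiDeriv_partialDeriv α i hφ.contDiff] at e
  rw [multiDeriv_add_single α i hφ.contDiff, e, order_add, order_single, pow_succ, mul_assoc] at e'
  simpa using mul_left_cancel₀ (pow_ne_zero _ (by norm_num)) e'

/-- `D^α` of `∂ᵢ u` is `D^{α + eᵢ} u`. -/
theorem HasWeakDeriv.add_single {α : Fin d → ℕ} {i : Fin d} {u v g : E d → ℝ}
    (h : HasWeakDeriv Ω (Pi.single i 1) u v) (h' : HasWeakDeriv Ω α v g) :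
    HasWeakDeriv Ω (α + Pi.single i 1) u g := by
  rw [hasWeakDeriv_iff]
  refine ⟨h.1, h'.2.1, fun φ hφ => ?_⟩
  have e := ((hasWeakDeriv_single_iff i u v).1 h).2.2 _ (hφ.multiDeriv α)
  rw [multiDeriv_add_single α i hφ.contDiff, e, h'.test hφ, order_add, order_single]
  ring

theorem HasWeakDeriv.add {α : Fin d → ℕ} {u v g g' : E d → ℝ}
    (h : HasWeakDeriv Ω α u g) (h' : HasWeakDeriv Ω α v g') :
    HasWeakDeriv Ω α (fun x => u x + v x) (fun x => g x + g' x) := by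
  rw [hasWeakDeriv_iff]
  refine ⟨h.1.add h'.1, h.2.1.add h'.2.1, fun φ hφ => ?_⟩
  simp only [add_mul]
  rw [integral_add ((hφ.multiDeriv α).integrable_mul h.1)
    ((hφ.multiDeriv α).integrable_mul h'.1), integral_add (hφ.integrable_mul h.2.1)
    (hφ.integrable_mul h'.2.1), h.test hφ, h'.test hφ, mul_add]

theorem HasWeakDeriv.sub {α : Fin d → ℕ} {u v g g' : E d → ℝ}
    (h : HasWeakDeriv Ω α u g) (h' : HasWeakDeriv Ω α v g') :
    HasWeakDeriv Ω α (fun x => u x - v x) (fun x => g x - g' x) := by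
  rw [hasWeakDeriv_iff]
  refine ⟨h.1.sub h'.1, h.2.1.sub h'.2.1, fun φ hφ => ?_⟩
  simp only [sub_mul]
  rw [integral_sub ((hφ.multiDeriv α).integrable_mul h.1)
    ((hφ.multiDeriv α).integrable_mul h'.1), integral_sub (hφ.integrable_mul h.2.1)
    (hφ.integrable_mul h'.2.1), h.test hφ, h'.test hφ, mul_sub]

/-- A classically differentiable function has its classical derivative as weak derivative. -/
theorem hasWeakDeriv_single_of_contDiff {u : E d → ℝ} (hu : ContDiff ℝ (⊤ : ℕ∞) u) (i : Fin d) :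
    HasWeakDeriv Ω (Pi.single i 1) u (partialDeriv i u) := by
  rw [hasWeakDeriv_single_iff]
  have hu' := contDiff_partialDeriv i hu
  refine ⟨hu.continuous.locallyIntegrable.locallyIntegrableOn _,
    hu'.continuous.locallyIntegrable.locallyIntegrableOn _, fun φ hφ => ?_⟩
  have hφ' := hφ.partialDeriv i
  rw [setIntegral_eq_integral_of_forall_compl_eq_zero,
    setIntegral_eq_integral_of_forall_compl_eq_zero]
  · refine integral_mul_fderiv_eq_neg_fderiv_mul_of_integrable ?_ ?_ ?_
      (fun x _ => hu.differentiable (by simp) x)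
      (fun x _ => hφ.contDiff.differentiable (by simp) x)
    · exact (hu'.continuous.mul hφ.contDiff.continuous).integrable_of_hasCompactSupport
        hφ.hasCompactSupport.mul_left
    · exact (hu.continuous.mul hφ'.contDiff.continuous).integrable_of_hasCompactSupport
        hφ'.hasCompactSupport.mul_left
    · exact (hu.continuous.mul hφ.contDiff.continuous).integrable_of_hasCompactSupport
        hφ.hasCompactSupport.mul_left
  · intro x hx
    rw [image_eq_zero_of_notMem_tsupport fun hxs => hx (hφ.tsupport_subset hxs), mul_zero]
  · intro x hx
    rw [image_eq_zero_of_notMem_tsupport fun hxs => hx (hφ'.tsupport_subset hxs), mul_zero]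

/-! ### Families of weak derivatives of a Sobolev function. -/

/-- A family of `L^p` functions closed under weak differentiation up to order `s`. -/
structure IsDerivFamily (Ω : Set (E d)) (s : ℕ) (p : ℝ≥0∞) (F : (Fin d → ℕ) → E d → ℝ) :
    Prop where
  memLp : ∀ α, order α ≤ s → MemLp (F α) p (volume.restrict Ω)
  hasWeakDeriv : ∀ α i, order α < s → HasWeakDeriv Ω (Pi.single i 1) (F α) (F (α + Pi.single i 1))

theorem hasWeakDeriv_weakDeriv {α : Fin d → ℕ} {u g : E d → ℝ} (h : HasWeakDeriv Ω α u g) :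
    HasWeakDeriv Ω α u (weakDeriv Ω α u) := by
  have h' : ∃ g, HasWeakDeriv Ω α u g := ⟨g, h⟩
  rw [weakDeriv, dif_pos h']
  exact h'.choose_spec

theorem MemSobolev.hasWeakDeriv {s : ℕ} {p : ℝ≥0∞} {u : E d → ℝ} (h : MemSobolev Ω s p u)
    {α : Fin d → ℕ} (hα : order α ≤ s) : HasWeakDeriv Ω α u (weakDeriv Ω α u) := by
  obtain ⟨g, hg, -⟩ := h.2 α hα
  exact hasWeakDeriv_weakDeriv hg

/-- The functions `weakDeriv Ω α u` are chosen independently for each `α`, yet they fit together,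
since being a weak derivative only involves integrals against test functions. Integrability passes
to them by a.e. uniqueness. -/
theorem MemSobolev.isDerivFamily (hΩ : IsOpen Ω) {s : ℕ} {p : ℝ≥0∞} {u : E d → ℝ}
    (h : MemSobolev Ω s p u) : IsDerivFamily Ω s p (fun α => weakDeriv Ω α u) where
  memLp α hα := by
    obtain ⟨g, hg, hgp⟩ := h.2 α hα
    exact hgp.ae_eq (hg.ae_eq hΩ (h.hasWeakDeriv hα))
  hasWeakDeriv α i hα := (h.hasWeakDeriv hα.le).single_of_add
    (h.hasWeakDeriv (by rw [order_add, order_single]; exact hα))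

theorem MemSobolev.weakDeriv_zero_ae_eq (hΩ : IsOpen Ω) {s : ℕ} {p : ℝ≥0∞} {u : E d → ℝ}
    (h : MemSobolev Ω s p u) : weakDeriv Ω 0 u =ᵐ[volume.restrict Ω] u := by
  have h0 := h.hasWeakDeriv (α := 0) (by simp)
  exact h0.ae_eq hΩ (hasWeakDeriv_zero h0.1)

end WADG

namespace WADG

open Filter Topology Convolution ContinuousLinearMap

variable {d : ℕ} {Ω : Set (E d)}

/-! ### Mollification -/

/-- The function `f`, extended by zero outside `Ω` and averaged against the bump function `η`. -/
noncomputable def mollify (Ω : Set (E d)) (η : ContDiffBump (0 : E d)) (f : E d → ℝ) : E d → ℝ :=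
  η.normed volume ⋆[lsmul ℝ ℝ, volume] Ω.indicator f

/-- Bump functions that shrink to the origin. -/
noncomputable def shrinkingBump (d k : ℕ) : ContDiffBump (0 : E d) where
  -- The bounded ratio `rOut = 2 rIn` is what a.e. convergence of the mollifications requires. The
  -- outer radius is half of `1 / (k + 1)`, so that its closed ball lies in the open ball of radius
  -- `1 / (k + 1)`.
  rIn := 1 / ((k : ℝ) + 1) / 4
  rOut := 1 / ((k : ℝ) + 1) / 2
  rIn_pos := by positivity
  rIn_lt_rOut := by
    have : 0 < 1 / ((k : ℝ) + 1) := by positivity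
    linarith

theorem tendsto_shrinkingBump_rOut (d : ℕ) :
    Tendsto (fun k => (shrinkingBump d k).rOut) atTop (𝓝 0) := by
  have h := (tendsto_one_div_add_atTop_nhds_zero_nat (𝕜 := ℝ)).div_const 2
  rwa [zero_div] at h

theorem mollify_apply (hΩ : MeasurableSet Ω) (η : ContDiffBump (0 : E d)) (f : E d → ℝ) (x : E d) :
    mollify Ω η f x = ∫ t in Ω, η.normed volume (x - t) * f t := by
  rw [mollify, convolution_eq_swap, ← integral_indicator hΩ]
  congr 1
  ext t
  by_cases ht : t ∈ Ω <;> simp [ht]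

theorem contDiff_mollify (hΩ : MeasurableSet Ω) (η : ContDiffBump (0 : E d)) {f : E d → ℝ}
    (hf : IntegrableOn f Ω) : ContDiff ℝ (⊤ : ℕ∞) (mollify Ω η f) :=
  η.hasCompactSupport_normed.contDiff_convolution_left _ η.contDiff_normed
    ((integrable_indicator_iff hΩ).2 hf).locallyIntegrable

theorem isTest_normed_sub (η : ContDiffBump (0 : E d)) {x : E d}
    (hx : Metric.closedBall x η.rOut ⊆ Ω) : IsTest Ω fun t => η.normed volume (x - t) := by
  have hs : tsupport (fun t => η.normed volume (x - t)) ⊆ Metric.closedBall x η.rOut := by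
    refine closure_minimal (fun t ht => ?_) Metric.isClosed_closedBall
    have h : x - t ∈ Function.support (η.normed volume) := ht
    rw [η.support_normed_eq, mem_ball_zero_iff] at h
    rw [mem_closedBall_iff_norm']
    exact h.le
  exact ⟨η.contDiff_normed.comp (contDiff_const.sub contDiff_id),
    (isCompact_closedBall x η.rOut).of_isClosed_subset (isClosed_tsupport _) hs, hs.trans hx⟩

/-- The derivative of the convolution falls on the bump. Since `t ↦ η (x - t)` is a test function in
`Ω` when the ball around `x` fits, the weak derivative identity moves it back to `f`; the sign of `x
- t` cancels the sign of integration by parts. -/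
theorem partialDeriv_mollify (hΩ : MeasurableSet Ω) (η : ContDiffBump (0 : E d)) {f g : E d → ℝ}
    {i : Fin d} (hf : IntegrableOn f Ω) (hfg : HasWeakDeriv Ω (Pi.single i 1) f g) {x : E d}
    (hx : Metric.closedBall x η.rOut ⊆ Ω) :
    partialDeriv i (mollify Ω η f) x = mollify Ω η g x := by
  have hφ := isTest_normed_sub η hx
  have hη : ContDiff ℝ 1 (η.normed (volume : Measure (E d))) := η.contDiff_normed
  have hf' := ((integrable_indicator_iff hΩ).2 hf).locallyIntegrable
  have h1 := η.hasCompactSupport_normed.hasFDerivAt_convolution_left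
    (lsmul ℝ ℝ : ℝ →L[ℝ] ℝ →L[ℝ] ℝ) hη hf' x
  have hint : ConvolutionExistsAt (fderiv ℝ (η.normed volume)) (Ω.indicator f) x
      ((lsmul ℝ ℝ : ℝ →L[ℝ] ℝ →L[ℝ] ℝ).precompL (E d)) volume :=
    (η.hasCompactSupport_normed.fderiv ℝ).convolutionExists_left _
      (hη.continuous_fderiv one_ne_zero) hf' x
  have h2 : partialDeriv i (mollify Ω η f) x =
      ∫ t, partialDeriv i (η.normed volume) t * Ω.indicator f (x - t) := by
    change fderiv ℝ (mollify Ω η f) x _ = _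
    rw [mollify, h1.fderiv, convolution, integral_apply hint]
    rfl
  have h3 : ∀ t, partialDeriv i (fun t => η.normed volume (x - t)) t =
      - partialDeriv i (η.normed volume) (x - t) := by
    intro t
    have := (hη.differentiable one_ne_zero (x - t)).hasFDerivAt.comp t
      ((hasFDerivAt_const x t).sub (hasFDerivAt_id t))
    change fderiv ℝ (η.normed volume ∘ fun t => x - t) t _ = _
    rw [HasFDerivAt.fderiv this]
    simp [partialDeriv]
  have h4 := ((hasWeakDeriv_single_iff i f g).1 hfg).2.2 _ hφ
  rw [h2, mollify_apply hΩ, ← integral_sub_left_eq_self _ volume x]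
  simp only [sub_sub_cancel]
  rw [← neg_inj]
  simp only [mul_comm _ (g _)]
  rw [← h4, ← integral_indicator hΩ, ← integral_neg]
  congr 1
  ext t
  by_cases ht : t ∈ Ω <;> simp [ht, h3, mul_comm]

theorem ae_tendsto_mollify (hΩ : MeasurableSet Ω) {f : E d → ℝ} (hf : IntegrableOn f Ω) :
    ∀ᵐ x ∂(volume.restrict Ω), Tendsto (fun k => mollify Ω (shrinkingBump d k) f x) atTop
      (𝓝 (f x)) := by
  have hl : LocallyIntegrable (Ω.indicator f) volume :=
    ((integrable_indicator_iff hΩ).2 hf).locallyIntegrable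
  have := ContDiffBump.ae_convolution_tendsto_right_of_locallyIntegrable (μ := volume)
    (g := Ω.indicator f) (φ := shrinkingBump d) (K := 2)
    (tendsto_shrinkingBump_rOut d) (.of_forall fun k => by simp only [shrinkingBump]; linarith) hl
  rw [ae_restrict_iff' hΩ]
  filter_upwards [this] with x hx hxΩ
  simpa [hxΩ, mollify] using hx

theorem abs_mollify_le (hΩ : MeasurableSet Ω) (η : ContDiffBump (0 : E d)) {f : E d → ℝ} {M : ℝ}
    (hM : 0 ≤ M) (hf : ∀ᵐ x ∂(volume.restrict Ω), |f x| ≤ M) (x : E d) :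
    |mollify Ω η f x| ≤ M := by
  have hint : Integrable fun t : E d => η.normed volume (x - t) := η.integrable_normed.comp_sub_left x
  rw [mollify_apply hΩ, ← Real.norm_eq_abs]
  calc ‖∫ t in Ω, η.normed volume (x - t) * f t‖
      ≤ ∫ t in Ω, η.normed volume (x - t) * M := by
        refine norm_integral_le_of_norm_le (hint.mul_const M).restrict ?_
        filter_upwards [hf] with t ht
        rw [norm_mul, Real.norm_of_nonneg (η.nonneg_normed _)]
        exact mul_le_mul_of_nonneg_left ht (η.nonneg_normed _)
    _ ≤ ∫ t, η.normed volume (x - t) * M :=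
        setIntegral_le_integral (hint.mul_const M)
          (.of_forall fun t => mul_nonneg (η.nonneg_normed _) hM)
    _ = M := by
        rw [integral_mul_const, integral_sub_left_eq_self (η.normed volume) volume x,
          η.integral_normed, one_mul]

/-- Cauchy–Schwarz for the splitting `f g = f^(1/2) · (f^(1/2) g)`. With `∫ f ≤ 1` it is Jensen's
inequality for the square, which is how it serves for mollifiers and for segments. -/
theorem lintegral_mul_sq_le {X : Type*} [MeasurableSpace X] {μ : Measure X} {f g : X → ℝ≥0∞}
    (hf : AEMeasurable f μ) (hg : AEMeasurable g μ) :
    (∫⁻ x, f x * g x ∂μ) ^ 2 ≤ (∫⁻ x, f x ∂μ) * ∫⁻ x, f x * g x ^ 2 ∂μ := by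
  have h := ENNReal.lintegral_mul_le_Lp_mul_Lq μ Real.HolderConjugate.two_two
    (hf.pow_const (1 / 2 : ℝ)) ((hf.pow_const (1 / 2 : ℝ)).mul hg)
  have e : ∀ a : ℝ≥0∞, a ^ (1 / 2 : ℝ) * a ^ (1 / 2 : ℝ) = a := fun a => by
    rw [← ENNReal.rpow_add_of_nonneg _ _ (by norm_num) (by norm_num)]; norm_num
  have e2 : ∀ a : ℝ≥0∞, (a ^ (1 / 2 : ℝ)) ^ 2 = a := fun a => by rw [sq, e]
  simp only [Pi.mul_apply, ENNReal.rpow_two, mul_pow, e2, ← mul_assoc, e] at h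
  calc (∫⁻ x, f x * g x ∂μ) ^ 2 ≤ _ := pow_le_pow_left' h 2
    _ = _ := by rw [mul_pow, e2, e2]

/-- Averaging contracts `L²`: pointwise Jensen against the unit mass of the bump, then Tonelli. -/
theorem lintegral_mollify_sq_le (hΩ : MeasurableSet Ω) (η : ContDiffBump (0 : E d)) {f : E d → ℝ}
    (hf : AEMeasurable f (volume.restrict Ω)) :
    ∫⁻ x, ‖mollify Ω η f x‖ₑ ^ 2 ≤ ∫⁻ x in Ω, ‖f x‖ₑ ^ 2 := by
  have hηm : Measurable (η.normed (volume : Measure (E d))) :=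
    η.continuous_normed.measurable
  have hη1 : ∫⁻ t, ‖η.normed volume t‖ₑ = 1 := by
    have : ∀ t, ‖η.normed volume t‖ₑ = ENNReal.ofReal (η.normed volume t) := fun t =>
      Real.enorm_of_nonneg (η.nonneg_normed t)
    simp_rw [this]
    rw [← ofReal_integral_eq_lintegral_ofReal η.integrable_normed
      (.of_forall η.nonneg_normed), η.integral_normed, ENNReal.ofReal_one]
  have key : ∀ x, ‖mollify Ω η f x‖ₑ ^ 2 ≤
      ∫⁻ t in Ω, ‖η.normed volume (x - t)‖ₑ * ‖f t‖ₑ ^ 2 := by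
    intro x
    rw [mollify_apply hΩ]
    calc ‖∫ t in Ω, η.normed volume (x - t) * f t‖ₑ ^ 2
        ≤ (∫⁻ t in Ω, ‖η.normed volume (x - t)‖ₑ * ‖f t‖ₑ) ^ 2 := by
          refine pow_le_pow_left' ((enorm_integral_le_lintegral_enorm _).trans_eq ?_) 2
          simp
      _ ≤ (∫⁻ t in Ω, ‖η.normed volume (x - t)‖ₑ) *
          ∫⁻ t in Ω, ‖η.normed volume (x - t)‖ₑ * ‖f t‖ₑ ^ 2 :=
          lintegral_mul_sq_le (by fun_prop) hf.enorm
      _ ≤ 1 * ∫⁻ t in Ω, ‖η.normed volume (x - t)‖ₑ * ‖f t‖ₑ ^ 2 := by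
          gcongr
          calc ∫⁻ t in Ω, ‖η.normed volume (x - t)‖ₑ ≤ ∫⁻ t, ‖η.normed volume (x - t)‖ₑ :=
                setLIntegral_le_lintegral _ _
            _ = 1 := by
              rw [lintegral_sub_left_eq_self (fun t => ‖η.normed volume t‖ₑ) x, hη1]
      _ = _ := one_mul _
  calc ∫⁻ x, ‖mollify Ω η f x‖ₑ ^ 2
      ≤ ∫⁻ x, ∫⁻ t in Ω, ‖η.normed volume (x - t)‖ₑ * ‖f t‖ₑ ^ 2 := lintegral_mono key
    _ = ∫⁻ t in Ω, ∫⁻ x, ‖η.normed volume (x - t)‖ₑ * ‖f t‖ₑ ^ 2 := by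
        have h1 : AEMeasurable (fun p : E d × E d => ‖η.normed volume (p.1 - p.2)‖ₑ)
            (volume.prod (volume.restrict Ω)) := by fun_prop
        exact lintegral_lintegral_swap (h1.mul (hf.enorm.pow_const 2).comp_snd)
    _ = ∫⁻ t in Ω, ‖f t‖ₑ ^ 2 := by
        congr 1
        ext t
        rw [lintegral_mul_const _ (by fun_prop),
          lintegral_sub_right_eq_self (fun x => ‖η.normed volume x‖ₑ) t, hη1, one_mul]

/-! ### The product rule for weak derivatives -/

theorem tendsto_integral_mul_mollify_mul (hΩ : MeasurableSet Ω) (hΩf : volume Ω ≠ ∞)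
    {v w φ : E d → ℝ} (hv : IntegrableOn v Ω) (hw : MemLp w ∞ (volume.restrict Ω))
    (hφ : IsTest Ω φ) :
    Tendsto (fun k => ∫ x in Ω, v x * (mollify Ω (shrinkingBump d k) w x * φ x)) atTop
      (𝓝 (∫ x in Ω, v x * (w x * φ x))) := by
  have : IsFiniteMeasure (volume.restrict Ω) := ⟨by simpa using hΩf.lt_top⟩
  have hw1 : IntegrableOn w Ω := hw.integrable le_top
  obtain ⟨C, hC⟩ := hφ.hasCompactSupport.exists_bound_of_continuous hφ.contDiff.continuous
  have hM : ∀ᵐ x ∂(volume.restrict Ω), |w x| ≤ (eLpNorm w ∞ (volume.restrict Ω)).toReal := by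
    filter_upwards [ae_le_eLpNormEssSup (f := w) (μ := volume.restrict Ω)] with x hx
    rw [← Real.norm_eq_abs, ← toReal_enorm]
    exact ENNReal.toReal_mono hw.2.ne (by simpa using hx)
  set M := (eLpNorm w ∞ (volume.restrict Ω)).toReal
  have hM0 : 0 ≤ M := ENNReal.toReal_nonneg
  refine tendsto_integral_of_dominated_convergence (fun x => |v x| * (M * C)) ?_
    (hv.abs.mul_const _) ?_ ?_
  · intro k
    exact hv.1.mul ((contDiff_mollify hΩ _ hw1).continuous.mul
      hφ.contDiff.continuous).aestronglyMeasurable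
  · refine fun k => .of_forall fun x => ?_
    rw [norm_mul, norm_mul, Real.norm_eq_abs, Real.norm_eq_abs]
    gcongr
    · exact abs_mollify_le hΩ _ hM0 hM x
    · exact hC x
  · filter_upwards [ae_tendsto_mollify hΩ hw1] with x hx
    exact (hx.mul_const _).const_mul _

theorem HasWeakDeriv.mul_single (hΩ : IsOpen Ω) (hΩf : volume Ω ≠ ∞) {i : Fin d}
    {u v w z : E d → ℝ} (hu : MemLp u 2 (volume.restrict Ω)) (hv : MemLp v 2 (volume.restrict Ω))
    (hw : MemLp w ∞ (volume.restrict Ω)) (hz : MemLp z ∞ (volume.restrict Ω))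
    (huv : HasWeakDeriv Ω (Pi.single i 1) u v) (hwz : HasWeakDeriv Ω (Pi.single i 1) w z) :
    HasWeakDeriv Ω (Pi.single i 1) (fun x => u x * w x) (fun x => v x * w x + u x * z x) := by
  have : IsFiniteMeasure (volume.restrict Ω) := ⟨by simpa using hΩf.lt_top⟩
  have hu1 : IntegrableOn u Ω := hu.integrable one_le_two
  have hv1 : IntegrableOn v Ω := hv.integrable one_le_two
  have hw1 : IntegrableOn w Ω := hw.integrable le_top
  have hvw : IntegrableOn (fun x => v x * w x) Ω := Integrable.mul_of_top_left hv1 hw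
  have huz : IntegrableOn (fun x => u x * z x) Ω := Integrable.mul_of_top_left hu1 hz
  have huw : IntegrableOn (fun x => u x * w x) Ω := Integrable.mul_of_top_left hu1 hw
  rw [hasWeakDeriv_single_iff]
  refine ⟨huw.locallyIntegrableOn, (hvw.add huz).locallyIntegrableOn, fun φ hφ => ?_⟩
  have hφ' := hφ.partialDeriv i
  have hm := hΩ.measurableSet
  have t1 := tendsto_integral_mul_mollify_mul hm hΩf hu1 hw hφ'
  have t2 := tendsto_integral_mul_mollify_mul hm hΩf hu1 hz hφ
  have t3 := tendsto_integral_mul_mollify_mul hm hΩf hv1 hw hφ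
  -- Once the bump radius is below `δ`, its balls around the support of `φ` stay in `Ω`, so there
  -- the mollification of `w` has the mollification of `z` as its derivative.
  obtain ⟨δ, hδ, hδΩ⟩ := IsCompact.exists_cthickening_subset_open hφ.hasCompactSupport hΩ
    hφ.tsupport_subset
  have hev : ∀ᶠ k in atTop,
      (∫ x in Ω, u x * (mollify Ω (shrinkingBump d k) w x * partialDeriv i φ x)) =
      -(∫ x in Ω, v x * (mollify Ω (shrinkingBump d k) w x * φ x)) -
      ∫ x in Ω, u x * (mollify Ω (shrinkingBump d k) z x * φ x) := by
    filter_upwards [(tendsto_shrinkingBump_rOut d).eventually_lt_const hδ] with k hk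
    set η := shrinkingBump d k
    have hsm := contDiff_mollify hm η hw1
    have hz1 : IntegrableOn z Ω := hz.integrable le_top
    have hψ : IsTest Ω fun x => mollify Ω η w x * φ x :=
      ⟨hsm.mul hφ.contDiff, hφ.hasCompactSupport.mul_left,
        (tsupport_mul_subset_right).trans hφ.tsupport_subset⟩
    have hψ1 : IsTest Ω fun x => mollify Ω η w x * partialDeriv i φ x :=
      ⟨hsm.mul hφ'.contDiff, hφ'.hasCompactSupport.mul_left,
        (tsupport_mul_subset_right).trans hφ'.tsupport_subset⟩
    have hψ2 : IsTest Ω fun x => mollify Ω η z x * φ x :=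
      ⟨(contDiff_mollify hm η hz1).mul hφ.contDiff, hφ.hasCompactSupport.mul_left,
        (tsupport_mul_subset_right).trans hφ.tsupport_subset⟩
    have hd : ∀ x, partialDeriv i (fun x => mollify Ω η w x * φ x) x =
        mollify Ω η w x * partialDeriv i φ x + mollify Ω η z x * φ x := by
      intro x
      have h1 : partialDeriv i (fun x => mollify Ω η w x * φ x) x =
          mollify Ω η w x * partialDeriv i φ x + partialDeriv i (mollify Ω η w) x * φ x := by
        unfold WADG.partialDeriv
        rw [fderiv_fun_mul (hsm.differentiable (by simp) x)
          (hφ.contDiff.differentiable (by simp) x)]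
        simp [mul_comm]
      rw [h1]
      by_cases hx : x ∈ tsupport φ
      · rw [partialDeriv_mollify hm η hw1 hwz]
        exact ((Metric.closedBall_subset_cthickening hx _).trans
          (Metric.cthickening_mono hk.le _)).trans hδΩ
      · simp [image_eq_zero_of_notMem_tsupport hx]
    -- With `w` mollified, `w φ` is itself a test function for `u`; the classical product rule then
    -- gives the identity before the limit.
    have e := ((hasWeakDeriv_single_iff i u v).1 huv).2.2 _ hψ
    simp only [hd, mul_add] at e
    rw [integral_add (hψ1.integrable_mul huv.1) (hψ2.integrable_mul huv.1)] at e
    linarith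
  have := tendsto_nhds_unique (t1.congr' hev) (t3.neg.sub t2)
  simp only [add_mul, mul_assoc]
  rw [this, integral_add]
  · ring
  · simpa only [mul_assoc] using hφ.integrable_mul hvw.locallyIntegrableOn
  · simpa only [mul_assoc] using hφ.integrable_mul huz.locallyIntegrableOn

/-- The product of an `L²` family and an `L^∞` family of derivatives has weak derivatives, with
the corresponding bounds. -/
theorem IsDerivFamily.exists_hasWeakDeriv_mul (hΩ : IsOpen Ω) (hΩf : volume Ω ≠ ∞) {s : ℕ}
    {U W : (Fin d → ℕ) → E d → ℝ} (hU : IsDerivFamily Ω s 2 U) (hW : IsDerivFamily Ω s ∞ W)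
    {A B : ℝ≥0∞} (hA : ∀ α, order α ≤ s → eLpNorm (U α) 2 (volume.restrict Ω) ≤ A)
    (hB : ∀ α, order α ≤ s → eLpNorm (W α) ∞ (volume.restrict Ω) ≤ B)
    (n : ℕ) (α β γ : Fin d → ℕ) (hα : order α = n) (hβ : order β + n ≤ s)
    (hγ : order γ + n ≤ s) :
    ∃ g, HasWeakDeriv Ω α (fun x => U β x * W γ x) g ∧ MemLp g 2 (volume.restrict Ω) ∧
      eLpNorm g 2 (volume.restrict Ω) ≤ 2 ^ n * (B * A) := by
  have : IsFiniteMeasure (volume.restrict Ω) := ⟨by simpa using hΩf.lt_top⟩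
  -- Each `∂ᵢ` splits one product into two, whence the factor `2 ^ n`; `β` and `γ` must vary because
  -- they record where the derivatives have fallen.
  induction n generalizing α β γ with
  | zero =>
    have h0 : α = 0 := by
      ext i
      exact (Finset.sum_eq_zero_iff.1 hα) i (Finset.mem_univ i)
    subst h0
    have hm : MemLp (fun x => U β x * W γ x) 2 (volume.restrict Ω) :=
      (hW.memLp γ hγ).mul (hU.memLp β hβ)
    refine ⟨fun x => U β x * W γ x,
      hasWeakDeriv_zero (IntegrableOn.locallyIntegrableOn (hm.integrable one_le_two)), hm, ?_⟩
    rw [pow_zero, one_mul]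
    calc eLpNorm (fun x => U β x * W γ x) 2 (volume.restrict Ω)
        = eLpNorm (W γ • U β) 2 (volume.restrict Ω) := by
          congr 1; ext x; simp [mul_comm]
      _ ≤ eLpNorm (W γ) ∞ (volume.restrict Ω) * eLpNorm (U β) 2 (volume.restrict Ω) :=
          eLpNorm_smul_le_eLpNorm_top_mul_eLpNorm 2 (hU.memLp β hβ).1 _
      _ ≤ B * A := mul_le_mul' (hB γ hγ) (hA β hβ)
  | succ n ih =>
    obtain ⟨α', i, hα', rfl⟩ := exists_eq_add_single hα
    obtain ⟨g₁, hg₁, hm₁, hb₁⟩ := ih α' (β + Pi.single i 1) γ hα'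
      (by rw [order_add, order_single]; omega) (by omega)
    obtain ⟨g₂, hg₂, hm₂, hb₂⟩ := ih α' β (γ + Pi.single i 1) hα'
      (by omega) (by rw [order_add, order_single]; omega)
    have hle : ∀ δ : Fin d → ℕ, order δ + (n + 1) ≤ s → order (δ + Pi.single i 1) ≤ s := by
      intro δ hδ
      rw [order_add, order_single]; omega
    refine ⟨fun x => g₁ x + g₂ x, HasWeakDeriv.add_single (HasWeakDeriv.mul_single hΩ hΩf
      (hU.memLp β (by omega)) (hU.memLp _ (hle β hβ)) (hW.memLp γ (by omega))
      (hW.memLp _ (hle γ hγ)) (hU.hasWeakDeriv β i (by omega)) (hW.hasWeakDeriv γ i (by omega)))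
      (hg₁.add hg₂), hm₁.add hm₂, ?_⟩
    calc eLpNorm (fun x => g₁ x + g₂ x) 2 (volume.restrict Ω)
        ≤ eLpNorm g₁ 2 (volume.restrict Ω) + eLpNorm g₂ 2 (volume.restrict Ω) :=
          eLpNorm_add_le hm₁.1 hm₂.1 one_le_two
      _ ≤ 2 ^ n * (B * A) + 2 ^ n * (B * A) := add_le_add hb₁ hb₂
      _ = _ := by ring

end WADG

namespace WADG

open Filter Topology

variable {d : ℕ}

/-! ### The Poincaré inequality on convex sets -/

theorem enorm_fderiv_sq_le (f : E d → ℝ) (z v : E d) {h : ℝ} (hv : ‖v‖ ≤ h) :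
    ‖fderiv ℝ f z v‖ₑ ^ 2 ≤ ENNReal.ofReal h ^ 2 * ∑ i, ‖partialDeriv i f z‖ₑ ^ 2 := by
  have h1 : fderiv ℝ f z v = ∑ i, v i * partialDeriv i f z := by
    conv_lhs => rw [← (EuclideanSpace.basisFun (Fin d) ℝ).sum_repr v]
    simp [map_sum, partialDeriv]
  have h2 : (fderiv ℝ f z v) ^ 2 ≤ h ^ 2 * ∑ i, partialDeriv i f z ^ 2 := by
    rw [h1]
    refine (Finset.sum_mul_sq_le_sq_mul_sq _ _ _).trans ?_
    refine mul_le_mul_of_nonneg_right ?_ (Finset.sum_nonneg fun i _ => sq_nonneg _)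
    rw [← EuclideanSpace.real_norm_sq_eq]
    exact pow_le_pow_left₀ (norm_nonneg v) hv 2
  have e : ∀ a : ℝ, ‖a‖ₑ ^ 2 = ENNReal.ofReal (a ^ 2) := fun a => by
    rw [← ofReal_norm, ← ENNReal.ofReal_pow (norm_nonneg a), Real.norm_eq_abs, sq_abs]
  simp only [e]
  rw [← ENNReal.ofReal_sum_of_nonneg fun i _ => sq_nonneg _,
    ← ENNReal.ofReal_pow ((norm_nonneg v).trans hv), ← ENNReal.ofReal_mul (sq_nonneg h)]
  exact ENNReal.ofReal_le_ofReal h2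

/-- The fundamental theorem of calculus on the segment from `y` to `x`, followed by Jensen on `(0,
1]`. -/
theorem enorm_sub_sq_le_lintegral_segment {f : E d → ℝ} (hf : ContDiff ℝ (⊤ : ℕ∞) f) {x y : E d}
    {h : ℝ} (hxy : dist x y ≤ h) :
    ‖f x - f y‖ₑ ^ 2 ≤ ENNReal.ofReal h ^ 2 *
      ∫⁻ t in Set.Ioc (0 : ℝ) 1, ∑ i, ‖partialDeriv i f (y + t • (x - y))‖ₑ ^ 2 := by
  have hc : Continuous fun t : ℝ => fderiv ℝ f (y + t • (x - y)) (x - y) :=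
    ((hf.continuous_fderiv (by simp)).comp (by fun_prop)).clm_apply continuous_const
  have h1 : f x - f y = ∫ t in Set.Ioc (0 : ℝ) 1, fderiv ℝ f (y + t • (x - y)) (x - y) := by
    rw [← intervalIntegral.integral_of_le zero_le_one,
      intervalIntegral.integral_eq_sub_of_hasDerivAt (f := fun t : ℝ => f (y + t • (x - y)))
        (fun t _ => ?_) (hc.intervalIntegrable _ _)]
    · simp
    · have := ((hf.differentiable (by simp) (y + t • (x - y))).hasFDerivAt).comp_hasDerivAt t
        (((hasDerivAt_id t).smul_const (x - y)).const_add y)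
      simpa [Function.comp_def] using this
  calc ‖f x - f y‖ₑ ^ 2
      ≤ (∫⁻ t in Set.Ioc (0 : ℝ) 1, 1 * ‖fderiv ℝ f (y + t • (x - y)) (x - y)‖ₑ) ^ 2 := by
        rw [h1]
        simp only [one_mul]
        exact pow_le_pow_left' (enorm_integral_le_lintegral_enorm _) 2
    _ ≤ (∫⁻ t in Set.Ioc (0 : ℝ) 1, 1) *
          ∫⁻ t in Set.Ioc (0 : ℝ) 1, 1 * ‖fderiv ℝ f (y + t • (x - y)) (x - y)‖ₑ ^ 2 :=
        lintegral_mul_sq_le aemeasurable_const hc.enorm.aemeasurable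
    _ ≤ ∫⁻ t in Set.Ioc (0 : ℝ) 1,
          ENNReal.ofReal h ^ 2 * ∑ i, ‖partialDeriv i f (y + t • (x - y))‖ₑ ^ 2 := by
        simp only [lintegral_const, Measure.restrict_apply_univ, Real.volume_Ioc, sub_zero,
          ENNReal.ofReal_one, one_mul]
        exact lintegral_mono fun t => enorm_fderiv_sq_le f _ _ (by rwa [← dist_eq_norm])
    _ = _ := lintegral_const_mul' _ _ (by simp)

/-- The homothety maps the convex set `S` into itself and its Jacobian contributes `s⁻ᵈ ≤ 2ᵈ`.
Keeping `s` away from `0` is what bounds this factor. -/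
theorem lintegral_comp_homothety_le {S : Set (E d)} (hS : Convex ℝ S) (hSm : MeasurableSet S)
    {G : E d → ℝ≥0∞} (hG : Measurable G) {a : E d} (ha : a ∈ S) {s : ℝ} (hs : 1 / 2 ≤ s)
    (hs1 : s ≤ 1) :
    ∫⁻ x in S, G (a + s • (x - a)) ≤ 2 ^ d * ∫⁻ x in S, G x := by
  have hs0 : 0 < s := by linarith
  have hGm : Measurable (S.indicator G) := hG.indicator hSm
  calc ∫⁻ x in S, G (a + s • (x - a))
      ≤ ∫⁻ x in S, S.indicator G (s • x + (a - s • a)) := by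
        refine setLIntegral_mono' hSm fun x hx => ?_
        have e : a + s • (x - a) = s • x + (a - s • a) := by rw [smul_sub]; abel
        have hmem : s • x + (a - s • a) ∈ S := by
          rw [← e]
          exact hS.add_smul_sub_mem ha hx ⟨hs0.le, hs1⟩
        rw [Set.indicator_of_mem hmem, e]
    _ ≤ ∫⁻ x, S.indicator G (s • x + (a - s • a)) := setLIntegral_le_lintegral _ _
    _ = ∫⁻ x, S.indicator G (x + (a - s • a)) ∂(Measure.map (s • ·) volume) := by
        rw [lintegral_map (by fun_prop) (by fun_prop)]
    _ = ENNReal.ofReal |(s ^ d)⁻¹| * ∫⁻ x in S, G x := by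
        rw [Measure.map_addHaar_smul _ hs0.ne', lintegral_smul_measure,
          lintegral_add_right_eq_self (fun x => S.indicator G x), lintegral_indicator hSm]
        simp
    _ ≤ 2 ^ d * ∫⁻ x in S, G x := by
        gcongr
        rw [abs_of_pos (by positivity), ← inv_pow, ENNReal.ofReal_pow (by positivity)]
        gcongr
        rw [show (2 : ℝ≥0∞) = ENNReal.ofReal 2 by simp]
        refine ENNReal.ofReal_le_ofReal ?_
        rw [inv_le_comm₀ hs0 two_pos]
        linarith

theorem lintegral_lintegral_enorm_sub_sq_le_of_contDiff {S : Set (E d)} (hS : Convex ℝ S)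
    (hSm : MeasurableSet S) (hSf : volume S ≠ ∞) {h : ℝ} (hh : ∀ x ∈ S, ∀ y ∈ S, dist x y ≤ h)
    {f : E d → ℝ} (hf : ContDiff ℝ (⊤ : ℕ∞) f) :
    ∫⁻ x in S, ∫⁻ y in S, ‖f x - f y‖ₑ ^ 2 ≤ ENNReal.ofReal h ^ 2 *
      (2 ^ d * (∫⁻ x in S, ∑ i, ‖partialDeriv i f x‖ₑ ^ 2) * volume S) := by
  have : IsFiniteMeasure (volume.restrict S) := ⟨by simpa using hSf.lt_top⟩
  set G : E d → ℝ≥0∞ := fun x => ∑ i, ‖partialDeriv i f x‖ₑ ^ 2 with hGdef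
  have hG : Measurable G :=
    Finset.measurable_sum _ fun i _ =>
      ((contDiff_partialDeriv i hf).continuous.measurable.enorm.pow_const 2)
  have hJ : ∀ t ∈ Set.Ioc (0 : ℝ) 1, ∫⁻ x in S, ∫⁻ y in S, G (y + t • (x - y)) ≤
      2 ^ d * (∫⁻ x in S, G x) * volume S := by
    intro t ht
    -- The point `y + t (x - y)` is a contraction by `t` in `x` and by `1 - t` in `y`. Integrating
    -- first in the variable with the larger ratio keeps that ratio at least `1/2`.
    rcases le_total (1 / 2) t with ht2 | ht2
    · rw [lintegral_lintegral_swap (by unfold Function.uncurry; fun_prop)]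
      calc ∫⁻ y in S, ∫⁻ x in S, G (y + t • (x - y))
          ≤ ∫⁻ y in S, 2 ^ d * ∫⁻ x in S, G x :=
            setLIntegral_mono' hSm fun y hy => lintegral_comp_homothety_le hS hSm hG hy ht2 ht.2
        _ = _ := by simp
    · calc ∫⁻ x in S, ∫⁻ y in S, G (y + t • (x - y))
          ≤ ∫⁻ x in S, 2 ^ d * ∫⁻ x in S, G x := by
            refine setLIntegral_mono' hSm fun x hx => ?_
            have e : ∀ y, y + t • (x - y) = x + (1 - t) • (y - x) := fun y => by module
            simp only [e]
            exact lintegral_comp_homothety_le hS hSm hG hx (by linarith) (by linarith [ht.1])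
        _ = _ := by simp
  calc ∫⁻ x in S, ∫⁻ y in S, ‖f x - f y‖ₑ ^ 2
      ≤ ∫⁻ x in S, ∫⁻ y in S, ENNReal.ofReal h ^ 2 *
          ∫⁻ t in Set.Ioc (0 : ℝ) 1, G (y + t • (x - y)) :=
        setLIntegral_mono' hSm fun x hx => setLIntegral_mono' hSm fun y hy =>
          enorm_sub_sq_le_lintegral_segment hf (hh x hx y hy)
    _ = ENNReal.ofReal h ^ 2 *
          ∫⁻ x in S, ∫⁻ y in S, ∫⁻ t in Set.Ioc (0 : ℝ) 1, G (y + t • (x - y)) := by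
        rw [← lintegral_const_mul' _ _ (by simp)]
        simp_rw [lintegral_const_mul' _ _ (show ENNReal.ofReal h ^ 2 ≠ ∞ by simp)]
    _ = ENNReal.ofReal h ^ 2 *
          ∫⁻ t in Set.Ioc (0 : ℝ) 1, ∫⁻ x in S, ∫⁻ y in S, G (y + t • (x - y)) := by
        congr 1
        have h1 : ∀ x, ∫⁻ y in S, ∫⁻ t in Set.Ioc (0 : ℝ) 1, G (y + t • (x - y)) =
            ∫⁻ t in Set.Ioc (0 : ℝ) 1, ∫⁻ y in S, G (y + t • (x - y)) := fun x =>
          lintegral_lintegral_swap (by unfold Function.uncurry; fun_prop)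
        simp only [h1]
        refine lintegral_lintegral_swap (Measurable.aemeasurable ?_)
        exact Measurable.lintegral_prod_right'
          (f := fun q : (E d × ℝ) × E d => G (q.2 + q.1.2 • (q.1.1 - q.2))) (by fun_prop)
    _ ≤ ENNReal.ofReal h ^ 2 *
          ∫⁻ t in Set.Ioc (0 : ℝ) 1, 2 ^ d * (∫⁻ x in S, G x) * volume S := by
        exact mul_le_mul_right (setLIntegral_mono' measurableSet_Ioc hJ) _
    _ = _ := by simp

/-- On this inner set mollification commutes with weak derivatives, and the smooth inequality needs
it convex: a point near `a x + b y` is the same combination of equally displaced points near `x` and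
`y`. -/
theorem convex_setOf_ball_subset {D : Set (E d)} (hD : Convex ℝ D) (ε : ℝ) :
    Convex ℝ {x | Metric.ball x ε ⊆ D} := by
  intro x hx y hy a b ha hb hab z hz
  have e : z = a • (x + (z - (a • x + b • y))) + b • (y + (z - (a • x + b • y))) := by
    have : ∀ v : E d, a • v + b • v = v := fun v => by rw [← add_smul, hab, one_smul]
    rw [smul_add, smul_add, add_add_add_comm, this]; abel
  have hz' : ‖z - (a • x + b • y)‖ < ε := by rwa [← dist_eq_norm]
  rw [e]
  exact hD (hx (by simpa using hz')) (hy (by simpa using hz')) ha hb hab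

theorem measurableSet_setOf_ball_subset (D : Set (E d)) (ε : ℝ) :
    MeasurableSet {x | Metric.ball x ε ⊆ D} := by
  have : {x | Metric.ball x ε ⊆ D} = (Metric.thickening ε Dᶜ)ᶜ := by
    ext x
    simp only [Set.mem_ofPred_eq, Set.mem_compl_iff, Metric.mem_thickening_iff, not_exists, not_and,
      Set.subset_def, Metric.mem_ball]
    exact forall_congr' fun z => by rw [dist_comm]; tauto
  rw [this]
  exact Metric.isOpen_thickening.measurableSet.compl

/-- The smooth inequality is applied to mollifications of `f` on the inner sets `S k`, which exhaust
`D`; its right-hand side is bounded uniformly in `k`, and Fatou's lemma passes to the limit. -/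
theorem lintegral_lintegral_enorm_sub_sq_le {D : Set (E d)} (hD : Convex ℝ D) (hDo : IsOpen D)
    (hDf : volume D ≠ ∞) {h : ℝ} (hh : ∀ x ∈ D, ∀ y ∈ D, dist x y ≤ h) {f : E d → ℝ}
    {g : Fin d → E d → ℝ} (hf : IntegrableOn f D)
    (hg : ∀ i, AEMeasurable (g i) (volume.restrict D))
    (hfg : ∀ i, HasWeakDeriv D (Pi.single i 1) f (g i)) :
    ∫⁻ x in D, ∫⁻ y in D, ‖f x - f y‖ₑ ^ 2 ≤ ENNReal.ofReal h ^ 2 *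
      (2 ^ d * (∑ i, ∫⁻ x in D, ‖g i x‖ₑ ^ 2) * volume D) := by
  have hDm := hDo.measurableSet
  have : IsFiniteMeasure (volume.restrict D) := ⟨by simpa using hDf.lt_top⟩
  set S : ℕ → Set (E d) := fun k => {x | Metric.ball x (1 / ((k : ℝ) + 1)) ⊆ D} with hSdef
  set F : ℕ → E d → ℝ := fun k => mollify D (shrinkingBump d k) f with hFdef
  have hSm : ∀ k, MeasurableSet (S k) := fun k => measurableSet_setOf_ball_subset D _
  have hSD : ∀ k, S k ⊆ D := fun k x hx => hx (Metric.mem_ball_self (by positivity))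
  have hF : ∀ k, ContDiff ℝ (⊤ : ℕ∞) (F k) := fun k => contDiff_mollify hDm _ hf
  have hFm : ∀ k, Measurable (F k) := fun k => (hF k).continuous.measurable
  have hSmem : ∀ x ∈ D, ∀ᶠ k in atTop, x ∈ S k := by
    intro x hx
    obtain ⟨ε, hε, hεD⟩ := Metric.isOpen_iff.1 hDo x hx
    filter_upwards [(tendsto_one_div_add_atTop_nhds_zero_nat (𝕜 := ℝ)).eventually_lt_const hε]
      with k hk
    exact (Metric.ball_subset_ball hk.le).trans hεD
  -- Cutting off by indicators moves the `k`-dependence from the domain to the integrand, so that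
  -- Fatou applies on the fixed set `D`.
  set H : ℕ → E d → E d → ℝ≥0∞ := fun k x y =>
    (S k).indicator (fun x => (S k).indicator (fun y => ‖F k x - F k y‖ₑ ^ 2) y) x with hHdef
  have hHm : ∀ k, Measurable (Function.uncurry (H k)) := by
    intro k
    have : Function.uncurry (H k) =
        (S k ×ˢ S k).indicator fun p => ‖F k p.1 - F k p.2‖ₑ ^ 2 := by
      ext ⟨x, y⟩
      by_cases hx : x ∈ S k <;> by_cases hy : y ∈ S k <;> simp [H, hx, hy]
    rw [this]
    have := hFm k
    exact Measurable.indicator (by fun_prop) ((hSm k).prod (hSm k))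
  have hbound : ∀ k, ∫⁻ x in D, ∫⁻ y in D, H k x y ≤ ENNReal.ofReal h ^ 2 *
      (2 ^ d * (∑ i, ∫⁻ x in D, ‖g i x‖ₑ ^ 2) * volume D) := by
    intro k
    have hball : ∀ x ∈ S k, Metric.closedBall x (shrinkingBump d k).rOut ⊆ D := fun x hx =>
      (Metric.closedBall_subset_ball (by
        have : 0 < 1 / ((k : ℝ) + 1) := by positivity
        change 1 / ((k : ℝ) + 1) / 2 < _
        linarith)).trans hx
    calc ∫⁻ x in D, ∫⁻ y in D, H k x y
        ≤ ∫⁻ x, ∫⁻ y, H k x y := (setLIntegral_le_lintegral _ _).trans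
          (lintegral_mono fun x => setLIntegral_le_lintegral _ _)
      _ = ∫⁻ x in S k, ∫⁻ y in S k, ‖F k x - F k y‖ₑ ^ 2 := by
          rw [← lintegral_indicator (hSm k)]
          congr 1
          ext x
          by_cases hx : x ∈ S k
          · simp [H, hx, lintegral_indicator (hSm k)]
          · simp [H, hx]
      _ ≤ ENNReal.ofReal h ^ 2 *
          (2 ^ d * (∫⁻ x in S k, ∑ i, ‖partialDeriv i (F k) x‖ₑ ^ 2) * volume (S k)) :=
          lintegral_lintegral_enorm_sub_sq_le_of_contDiff (convex_setOf_ball_subset hD _) (hSm k)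
            (measure_ne_top_of_subset (hSD k) hDf)
            (fun x hx y hy => hh x (hSD k hx) y (hSD k hy)) (hF k)
      _ ≤ _ := by
          refine mul_le_mul_right (mul_le_mul' (mul_le_mul_right ?_ _) ?_) _
          · calc ∫⁻ x in S k, ∑ i, ‖partialDeriv i (F k) x‖ₑ ^ 2
                = ∫⁻ x in S k, ∑ i, ‖mollify D (shrinkingBump d k) (g i) x‖ₑ ^ 2 := by
                  refine setLIntegral_congr_fun (hSm k) fun x hx => ?_
                  refine Finset.sum_congr rfl fun i _ => ?_
                  rw [partialDeriv_mollify hDm _ hf (hfg i) (hball x hx)]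
              _ ≤ ∑ i, ∫⁻ x in S k, ‖mollify D (shrinkingBump d k) (g i) x‖ₑ ^ 2 := by
                  rw [lintegral_finsetSum' _ fun i _ => ?_]
                  -- Measurability is read off the smooth function `F k`, since `g i` is only
                  -- assumed a.e. measurable.
                  refine AEMeasurable.congr (f := fun x => ‖partialDeriv i (F k) x‖ₑ ^ 2) ?_ ?_
                  · exact ((contDiff_partialDeriv i (hF k)).continuous.measurable.enorm.pow_const
                      2).aemeasurable
                  · filter_upwards [ae_restrict_mem (hSm k)] with x hx
                    rw [partialDeriv_mollify hDm _ hf (hfg i) (hball x hx)]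
              _ ≤ ∑ i, ∫⁻ x in D, ‖g i x‖ₑ ^ 2 := Finset.sum_le_sum fun i _ =>
                  (setLIntegral_le_lintegral _ _).trans (lintegral_mollify_sq_le hDm _ (hg i))
          · exact measure_mono (hSD k)
  have hlim : ∀ᵐ x ∂(volume.restrict D), ∀ᵐ y ∂(volume.restrict D),
      Tendsto (fun k => H k x y) atTop (𝓝 (‖f x - f y‖ₑ ^ 2)) := by
    have h1 := ae_tendsto_mollify hDm hf
    have h2 := ae_restrict_mem (μ := volume) hDm
    filter_upwards [h1, h2] with x hx hxD
    filter_upwards [h1, h2] with y hy hyD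
    have h3 : Tendsto (fun k => ‖F k x - F k y‖ₑ ^ 2) atTop (𝓝 (‖f x - f y‖ₑ ^ 2)) :=
      ((ENNReal.continuous_pow 2).tendsto _).comp ((hx.sub hy).enorm)
    refine h3.congr' ?_
    filter_upwards [hSmem x hxD, hSmem y hyD] with k hkx hky
    simp [H, hkx, hky]
  calc ∫⁻ x in D, ∫⁻ y in D, ‖f x - f y‖ₑ ^ 2
      ≤ ∫⁻ x in D, liminf (fun k => ∫⁻ y in D, H k x y) atTop := by
        refine lintegral_mono_ae ?_
        filter_upwards [hlim] with x hx
        calc ∫⁻ y in D, ‖f x - f y‖ₑ ^ 2 = ∫⁻ y in D, liminf (fun k => H k x y) atTop := by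
              refine lintegral_congr_ae ?_
              filter_upwards [hx] with y hy using hy.liminf_eq.symm
          _ ≤ _ := lintegral_liminf_le fun k => (hHm k).of_uncurry_left
    _ ≤ liminf (fun k => ∫⁻ x in D, ∫⁻ y in D, H k x y) atTop :=
        lintegral_liminf_le fun k => (hHm k).lintegral_prod_right'
    _ ≤ _ := liminf_le_of_frequently_le' (.of_forall hbound)

theorem eLpNorm_two_sq {X : Type*} [MeasurableSpace X] {μ : Measure X} (f : X → ℝ) :
    eLpNorm f 2 μ ^ 2 = ∫⁻ x, ‖f x‖ₑ ^ 2 ∂μ := by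
  simpa using eLpNorm_nnreal_pow_eq_lintegral (p := 2) (f := f) (μ := μ) two_ne_zero

/-- The Poincaré inequality on a convex set, for the distance to the constants. -/
theorem exists_eLpNorm_sub_const_le {D : Set (E d)} (hD : Convex ℝ D) (hDo : IsOpen D)
    (hDn : D.Nonempty) (hDf : volume D ≠ ∞) {h : ℝ} (hh : ∀ x ∈ D, ∀ y ∈ D, dist x y ≤ h)
    {f : E d → ℝ} {g : Fin d → E d → ℝ} (hf : MemLp f 2 (volume.restrict D))
    (hg : ∀ i, MemLp (g i) 2 (volume.restrict D))
    (hfg : ∀ i, HasWeakDeriv D (Pi.single i 1) f (g i)) {M : ℝ≥0∞}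
    (hM : ∀ i, eLpNorm (g i) 2 (volume.restrict D) ≤ M) :
    ∃ c : ℝ, eLpNorm (fun x => f x - c) 2 (volume.restrict D) ≤ 2 ^ d * ENNReal.ofReal h * M := by
  have : IsFiniteMeasure (volume.restrict D) := ⟨by simpa using hDf.lt_top⟩
  have h0 : volume D ≠ 0 := (hDo.measure_pos volume hDn).ne'
  have key := lintegral_lintegral_enorm_sub_sq_le hD hDo hDf hh (hf.integrable one_le_two)
    (fun i => (hg i).1.aemeasurable) hfg
  have hfm := hf.1.aemeasurable
  have hm : AEMeasurable (fun x => ∫⁻ y in D, ‖f x - f y‖ₑ ^ 2) (volume.restrict D) :=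
    AEMeasurable.lintegral_prod_right' (f := fun p : E d × E d => ‖f p.1 - f p.2‖ₑ ^ 2)
      ((hfm.comp_fst.sub hfm.comp_snd).enorm.pow_const 2)
  -- The constant is a value `f z` rather than the mean: some `z` makes the integral of `|f z - f
  -- y|²` over `y` at most its average over `z`.
  obtain ⟨z, -, hz⟩ := exists_le_setLAverage h0 hDf hm
  refine ⟨f z, ?_⟩
  rw [setLAverage_eq] at hz
  -- Replacing the number `d` of partial derivatives by `2 ^ d` makes the final bound the perfect
  -- square of `2 ^ d * h * M`.
  have hd : (d : ℝ≥0∞) ≤ 2 ^ d := by exact_mod_cast Nat.lt_two_pow_self.le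
  rw [← ENNReal.pow_le_pow_left_iff two_ne_zero, eLpNorm_two_sq]
  calc ∫⁻ x in D, ‖f x - f z‖ₑ ^ 2 = ∫⁻ x in D, ‖f z - f x‖ₑ ^ 2 := by
        congr 1; ext x; rw [enorm_sub_rev]
    _ ≤ _ := hz
    _ ≤ ENNReal.ofReal h ^ 2 * (2 ^ d * (∑ i, ∫⁻ x in D, ‖g i x‖ₑ ^ 2)) := by
        rw [ENNReal.div_le_iff h0 hDf, mul_assoc]
        exact key
    _ ≤ ENNReal.ofReal h ^ 2 * (2 ^ d * (2 ^ d * M ^ 2)) := by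
        gcongr
        calc ∑ i, ∫⁻ x in D, ‖g i x‖ₑ ^ 2 ≤ ∑ i : Fin d, M ^ 2 := by
              refine Finset.sum_le_sum fun i _ => ?_
              rw [← eLpNorm_two_sq]
              exact pow_le_pow_left' (hM i) 2
          _ = d * M ^ 2 := by simp
          _ ≤ _ := by gcongr
    _ = _ := by ring

end WADG

namespace WADG

variable {d : ℕ}

/-! ### Polynomials with prescribed leading derivatives -/

theorem contDiff_polyEval (p : MvPolynomial (Fin d) ℝ) :
    ContDiff ℝ (⊤ : ℕ∞) (polyEval d p) :=
  (analyticOnNhd_of_mem_polySpace (N := p.totalDegree)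
    ⟨p, (MvPolynomial.mem_restrictTotalDegree _ _ _).2 le_rfl, rfl⟩).contDiff

theorem partialDeriv_polyEval (i : Fin d) (p : MvPolynomial (Fin d) ℝ) :
    partialDeriv i (polyEval d p) = polyEval d (MvPolynomial.pderiv i p) := by
  have hdiff : ∀ p, Differentiable ℝ (polyEval d p) := fun p =>
    (contDiff_polyEval p).differentiable (by simp)
  induction p using MvPolynomial.induction_on with
  | C a =>
    ext x
    have : polyEval d (MvPolynomial.C a) = fun _ => a := by ext; simp [polyEval]
    simp [partialDeriv, this]
  | add p q hp hq =>
    rw [map_add, map_add, map_add, ← hp, ← hq]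
    ext x
    simp only [partialDeriv, Pi.add_apply]
    rw [fderiv_add (hdiff p x) (hdiff q x)]
    simp
  | mul_X p j hp =>
    have e : ∀ q, polyEval d (q * MvPolynomial.X j) = fun x => polyEval d q x * x j := by
      intro q; ext x; simp [polyEval]
    have hX : ∀ x : E d, HasFDerivAt (fun x : E d => x j)
        (EuclideanSpace.proj j : E d →L[ℝ] ℝ) x :=
      fun x => (EuclideanSpace.proj j : E d →L[ℝ] ℝ).hasFDerivAt
    rw [MvPolynomial.pderiv_mul, map_add, e, e, ← hp]
    ext x
    simp only [partialDeriv, Pi.add_apply]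
    rw [((hdiff p x).hasFDerivAt.fun_mul (hX x)).fderiv]
    rcases eq_or_ne j i with rfl | hij
    · simp [polyEval]; ring
    · simp [polyEval, MvPolynomial.pderiv_X_of_ne hij, hij]; ring

theorem order_coe_finsupp (m : Fin d →₀ ℕ) : order (m : Fin d → ℕ) = m.sum fun _ e => e :=
  (Finsupp.sum_fintype m (fun _ e => e) fun _ => rfl).symm

/-- The polynomial `∑ c (m + α) x^m / m!`, where the sum is over the `m` with `|m| + |α| = n`. -/
noncomputable def taylorPoly (n : ℕ) (c : (Fin d → ℕ) → ℝ) (α : Fin d → ℕ) :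
    MvPolynomial (Fin d) ℝ :=
  ∑ m ∈ multiIndices d n, MvPolynomial.monomial (Finsupp.equivFunOnFinite.symm m)
    (if order (m + α) = n then c (m + α) / ∏ i, ((m i).factorial : ℝ) else 0)

theorem coeff_taylorPoly (n : ℕ) (c : (Fin d → ℕ) → ℝ) (α : Fin d → ℕ) (m : Fin d →₀ ℕ) :
    (taylorPoly n c α).coeff m =
      if order (⇑m + α) = n then c (⇑m + α) / ∏ i, ((m i).factorial : ℝ) else 0 := by
  have e : ∀ m' : Fin d → ℕ, (Finsupp.equivFunOnFinite.symm m' = m) = (m' = ⇑m) := fun m' => by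
    rw [Equiv.symm_apply_eq]; rfl
  simp only [taylorPoly, MvPolynomial.coeff_sum, MvPolynomial.coeff_monomial, e]
  rw [Finset.sum_ite_eq' (multiIndices d n) (⇑m)
    fun m => if order (m + α) = n then c (m + α) / ∏ i, ((m i).factorial : ℝ) else 0]
  by_cases h : order (⇑m + α) = n
  · rw [if_pos]
    rw [mem_multiIndices, ← h, order_add]
    exact Nat.le_add_right _ _
  · simp [h]

/-- The factorials absorb the exponent produced by differentiation. Thus all derivatives of one
polynomial are again `taylorPoly`s, ending in the constants `c α` at order `n`. -/
theorem pderiv_taylorPoly (n : ℕ) (c : (Fin d → ℕ) → ℝ) (α : Fin d → ℕ) (i : Fin d) :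
    MvPolynomial.pderiv i (taylorPoly n c α) = taylorPoly n c (α + Pi.single i 1) := by
  ext m
  rw [MvPolynomial.coeff_pderiv, coeff_taylorPoly, coeff_taylorPoly]
  have e : (⇑(m + Finsupp.single i 1 : Fin d →₀ ℕ) + α : Fin d → ℕ) = ⇑m + (α + Pi.single i 1) := by
    rw [Finsupp.coe_add, Finsupp.single_eq_pi_single]; abel
  have e2 : (∏ j, (((m + Finsupp.single i 1 : Fin d →₀ ℕ) j).factorial : ℝ)) =
      (m i + 1) * ∏ j, ((m j).factorial : ℝ) := by
    rw [← Finset.mul_prod_erase _ _ (Finset.mem_univ i),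
      ← Finset.mul_prod_erase Finset.univ (fun j => ((m j).factorial : ℝ)) (Finset.mem_univ i),
      ← mul_assoc]
    congr 1
    · simp [Nat.factorial_succ]
    · refine Finset.prod_congr rfl fun j hj => ?_
      simp [Finset.ne_of_mem_erase hj]
  rw [e, e2]
  split_ifs
  · have h1 : (m i + 1 : ℝ) ≠ 0 := by positivity
    have h2 : (∏ j, ((m j).factorial : ℝ)) ≠ 0 :=
      Finset.prod_ne_zero_iff.2 fun j _ => by positivity
    field_simp
  · simp

theorem polyEval_taylorPoly_mem (n : ℕ) (c : (Fin d → ℕ) → ℝ) (α : Fin d → ℕ) :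
    polyEval d (taylorPoly n c α) ∈ polySpace d n := by
  refine ⟨_, ?_, rfl⟩
  rw [SetLike.mem_coe, MvPolynomial.mem_restrictTotalDegree]
  refine Finset.sup_le fun m hm => ?_
  rw [MvPolynomial.mem_support_iff, coeff_taylorPoly] at hm
  rw [← order_coe_finsupp]
  by_contra! h
  refine hm (if_neg ?_)
  rw [order_add]
  omega

theorem polyEval_taylorPoly_of_order_eq {n : ℕ} (c : (Fin d → ℕ) → ℝ) {α : Fin d → ℕ}
    (hα : order α = n) : polyEval d (taylorPoly n c α) = fun _ => c α := by
  have : taylorPoly n c α = MvPolynomial.C (c α) := by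
    ext m
    rw [coeff_taylorPoly, MvPolynomial.coeff_C]
    by_cases hm : 0 = m
    · subst hm; simp [hα]
    · rw [if_neg hm, if_neg]
      intro h
      have h0 : order (⇑m : Fin d → ℕ) = 0 := by rw [order_add] at h; omega
      exact hm (Finsupp.ext fun i => ((Finset.sum_eq_zero_iff.1 h0) i (Finset.mem_univ i)).symm)
  rw [this]
  ext x
  simp [polyEval]

theorem polySpace_mono {m n : ℕ} (h : m ≤ n) : polySpace d m ≤ polySpace d n := by
  refine Submodule.map_mono fun p hp => ?_
  rw [MvPolynomial.mem_restrictTotalDegree] at hp ⊢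
  exact hp.trans h

/-! ### Polynomial approximation on convex sets -/

theorem memLp_of_continuous {D : Set (E d)} (hDb : Bornology.IsBounded D) {q : E d → ℝ}
    (hq : Continuous q) (p : ℝ≥0∞) : MemLp q p (volume.restrict D) := by
  have : IsFiniteMeasure (volume.restrict D) := ⟨by simpa using hDb.measure_lt_top⟩
  obtain ⟨C, hC⟩ := hDb.isCompact_closure.exists_bound_of_continuousOn hq.continuousOn
  refine MemLp.of_bound hq.aestronglyMeasurable C ?_
  exact ae_restrict_of_ae_restrict_of_subset subset_closure
    ((ae_restrict_iff' isClosed_closure.measurableSet).2 (.of_forall hC))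

/-- The Bramble–Hilbert lemma on a convex set. -/
theorem exists_mem_polySpace_eLpNorm_sub_le {D : Set (E d)} (hD : Convex ℝ D) (hDo : IsOpen D)
    (hDn : D.Nonempty) (hDb : Bornology.IsBounded D) (N n : ℕ) (hn : n ≤ N + 1)
    {F : (Fin d → ℕ) → E d → ℝ} (hF : IsDerivFamily D n 2 F) {M : ℝ≥0∞}
    (hM : ∀ α, order α = n → eLpNorm (F α) 2 (volume.restrict D) ≤ M) :
    ∃ p ∈ polySpace d N, eLpNorm (fun x => F 0 x - p x) 2 (volume.restrict D) ≤
      (2 ^ d * ENNReal.ofReal (Metric.diam D)) ^ n * M := by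
  induction n generalizing F M with
  | zero => exact ⟨0, zero_mem _, by simpa using hM 0 order_zero⟩
  | succ n ih =>
    -- Poincaré applied to each derivative of order `n`; the value `0` at other orders never enters.
    have hc : ∀ β : Fin d → ℕ, ∃ c : ℝ, order β = n →
        eLpNorm (fun x => F β x - c) 2 (volume.restrict D) ≤
          2 ^ d * ENNReal.ofReal (Metric.diam D) * M := by
      intro β
      by_cases hβ : order β = n
      · have h1 : ∀ i, order (β + Pi.single i 1) = n + 1 := fun i => by
          rw [order_add, order_single, hβ]
        obtain ⟨c, hc⟩ := exists_eLpNorm_sub_const_le hD hDo hDn hDb.measure_lt_top.ne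
          (fun x hx y hy => Metric.dist_le_diam_of_mem hDb hx hy) (hF.memLp β (by omega))
          (fun i => hF.memLp (β + Pi.single i 1) (h1 i).le)
          (fun i => hF.hasWeakDeriv β i (by omega)) (fun i => hM _ (h1 i))
        exact ⟨c, fun _ => hc⟩
      · exact ⟨0, fun h => absurd h hβ⟩
    choose c hc using hc
    -- Subtracting a polynomial of degree `n` with derivatives `c β` leaves order `n` derivatives
    -- already bounded with one factor of `2 ^ d * diam D`; the induction hypothesis supplies the
    -- other `n`.
    have hF' : IsDerivFamily D n 2 fun α x => F α x - polyEval d (taylorPoly n c α) x :=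
      { memLp := fun α hα => (hF.memLp α (by omega)).sub
          (memLp_of_continuous hDb (contDiff_polyEval _).continuous 2)
        hasWeakDeriv := fun α i hα => by
          have h := hasWeakDeriv_single_of_contDiff (Ω := D)
            (contDiff_polyEval (taylorPoly n c α)) i
          rw [partialDeriv_polyEval, pderiv_taylorPoly] at h
          exact (hF.hasWeakDeriv α i (by omega)).sub h }
    obtain ⟨p, hp, hpb⟩ := ih (by omega) hF' (fun α hα => by
      simp only [polyEval_taylorPoly_of_order_eq c hα]
      exact hc α hα)
    refine ⟨polyEval d (taylorPoly n c 0) + p,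
      add_mem (polySpace_mono (by omega) (polyEval_taylorPoly_mem n c 0)) hp, ?_⟩
    simp only [Pi.add_apply, ← sub_sub]
    refine hpb.trans_eq ?_
    ring

end WADG

namespace WADG

variable {d : ℕ}

/-! ### Affine elements -/

theorem isOpen_refSimplex (d : ℕ) : IsOpen (refSimplex d) := by
  refine IsOpen.and ?_ (isOpen_lt (by fun_prop) continuous_const)
  simp only [Set.ofPred_forall]
  exact isOpen_iInter_of_finite fun i => isOpen_lt continuous_const (by fun_prop)

theorem convex_refSimplex (d : ℕ) : Convex ℝ (refSimplex d) := by
  rintro x ⟨hx, hx'⟩ y ⟨hy, hy'⟩ a b ha hb hab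
  have key : ∀ {s t c : ℝ}, s < c → t < c → a * s + b * t < c := by
    intro s t c hs ht
    have h := convex_Iio c (x := s) (y := t) hs ht ha hb hab
    simpa using h
  constructor
  · intro i
    have := key (neg_lt_neg (hx i)) (neg_lt_neg (hy i))
    simp only [PiLp.add_apply, PiLp.smul_apply, smul_eq_mul]
    linarith
  · simpa [Finset.sum_add_distrib, Finset.mul_sum] using key hx' hy'

theorem isBounded_refSimplex (d : ℕ) : Bornology.IsBounded (refSimplex d) := by
  refine (Metric.isBounded_iff_subset_closedBall 0).2 ⟨√d, fun x hx => ?_⟩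
  rw [mem_closedBall_zero_iff]
  refine Real.le_sqrt_of_sq_le ?_
  rw [EuclideanSpace.real_norm_sq_eq]
  calc ∑ i, x i ^ 2 ≤ ∑ _i : Fin d, (1 : ℝ) := by
        refine Finset.sum_le_sum fun i _ => ?_
        -- The numbers `x j + 1` are positive with sum below `2`, so every coordinate lies in `(-1,
        -- 1)`.
        have h1 : x i + 1 ≤ ∑ j, (x j + 1) :=
          Finset.single_le_sum (f := fun j => x j + 1) (fun j _ => by linarith [hx.1 j])
            (Finset.mem_univ i)
        have h2 : ∑ j, (x j + 1) = ∑ j, x j + d := by simp [Finset.sum_add_distrib]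
        have h3 := hx.2
        have h4 := hx.1 i
        nlinarith
    _ = d := by simp

theorem IsAffineElement.isOpen {D : Set (E d)} (h : IsAffineElement D) : IsOpen D := by
  obtain ⟨Φ, rfl⟩ := h
  exact Φ.toContinuousAffineEquiv.toHomeomorph.isOpenMap _ (isOpen_refSimplex d)

theorem IsAffineElement.convex {D : Set (E d)} (h : IsAffineElement D) : Convex ℝ D := by
  obtain ⟨Φ, rfl⟩ := h
  exact (convex_refSimplex d).affine_image Φ.toAffineMap

theorem IsAffineElement.isBounded {D : Set (E d)} (h : IsAffineElement D) :
    Bornology.IsBounded D := by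
  obtain ⟨Φ, rfl⟩ := h
  exact ((isBounded_refSimplex d).isCompact_closure.image
    Φ.toContinuousAffineEquiv.continuous).isBounded.subset
    (Set.image_mono subset_closure)

theorem IsQuasiRegular.nonempty {σ : ℝ} {D : Set (E d)} (h : IsQuasiRegular σ D) :
    D.Nonempty := by
  obtain ⟨c, r, hr, hD, -⟩ := h
  exact ⟨c, hD (Metric.mem_ball_self hr)⟩

/-! ### Weighted projections -/

theorem isWeightedProj_TInv {D : Set (E d)} (hDo : IsOpen D) (hDn : D.Nonempty)
    (hDb : Bornology.IsBounded D) (N : ℕ) {w f : E d → ℝ} (hw : MemLp w ∞ (volume.restrict D))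
    {a : ℝ} (ha : 0 < a) (haw : ∀ᵐ x ∂(volume.restrict D), a ≤ w x)
    (hf : MemLp f 2 (volume.restrict D)) : IsWeightedProj D N w f (TInv D N w f) := by
  have h := (existsUnique_isWeightedProj hDo hDn hDb N hw ha haw hf).exists
  rw [TInv, dif_pos h]
  exact h.choose_spec

theorem ofReal_integral_sq {X : Type*} [MeasurableSpace X] {μ : Measure X} {f : X → ℝ}
    (hf : MemLp f 2 μ) : ENNReal.ofReal (∫ x, f x ^ 2 ∂μ) = eLpNorm f 2 μ ^ 2 := by
  rw [eLpNorm_two_sq, ofReal_integral_eq_lintegral_ofReal hf.integrable_sq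
    (.of_forall fun x => sq_nonneg _)]
  congr 1
  ext x
  rw [← ofReal_norm, ← ENNReal.ofReal_pow (norm_nonneg _), Real.norm_eq_abs, sq_abs]

/-- The weighted projection is quasi-optimal. -/
theorem IsWeightedProj.eLpNorm_sub_sq_le {D : Set (E d)} (hDb : Bornology.IsBounded D) {N : ℕ}
    {a f g q p : E d → ℝ} (hq : IsWeightedProj D N a f q) (ha : MemLp a ∞ (volume.restrict D))
    (hg : MemLp g 2 (volume.restrict D)) (hfg : f =ᵐ[volume.restrict D] fun x => a x * g x)
    {m M : ℝ} (hm : 0 ≤ m) (hM : 0 ≤ M) (hma : ∀ᵐ x ∂(volume.restrict D), m ≤ a x)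
    (haM : ∀ᵐ x ∂(volume.restrict D), a x ≤ M) (hp : p ∈ polySpace d N) :
    ENNReal.ofReal m * eLpNorm (fun x => g x - q x) 2 (volume.restrict D) ^ 2 ≤
      ENNReal.ofReal M * eLpNorm (fun x => g x - p x) 2 (volume.restrict D) ^ 2 := by
  have hL : ∀ v ∈ polySpace d N, MemLp v 2 (volume.restrict D) := fun v hv =>
    memLp_of_continuous hDb
      (continuousOn_univ.1 (analyticOnNhd_of_mem_polySpace hv).continuousOn) 2
  have hI : ∀ {r s : E d → ℝ}, MemLp r 2 (volume.restrict D) → MemLp s 2 (volume.restrict D) →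
      Integrable (fun x => a x * (r x * s x)) (volume.restrict D) := fun hr hs =>
    (hr.integrable_mul hs).mul_of_top_right ha
  have hr : MemLp (fun x => g x - q x) 2 (volume.restrict D) := hg.sub (hL q hq.1)
  have hgp : MemLp (fun x => g x - p x) 2 (volume.restrict D) := hg.sub (hL p hp)
  have hsp : q - p ∈ polySpace d N := sub_mem hq.1 hp
  have hs := hL _ hsp
  -- Galerkin orthogonality: the defining equation tested with `q - p ∈ P^N`.
  have horth : ∫ x in D, a x * ((g x - q x) * (q - p) x) = 0 := by
    have h1 := hq.2 _ hsp
    have h2 : ∫ x in D, f x * (q - p) x = ∫ x in D, a x * (g x * (q - p) x) := by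
      refine integral_congr_ae ?_
      filter_upwards [hfg] with x hx
      rw [hx, mul_assoc]
    simp only [sub_mul, mul_sub]
    rw [integral_sub (hI hg hs) (hI (hL q hq.1) hs), ← h2, ← h1]
    simp [mul_assoc]
  -- Pythagoras in the weighted inner product, dropping the nonnegative term `a (q - p)²`.
  have hmain : ∫ x in D, a x * ((g x - q x) * (g x - q x)) ≤
      ∫ x in D, a x * ((g x - p x) * (g x - p x)) := by
    calc ∫ x in D, a x * ((g x - q x) * (g x - q x))
        = ∫ x in D, (a x * ((g x - q x) * (g x - q x)) +
            2 * (a x * ((g x - q x) * (q - p) x))) := by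
          rw [integral_add (hI hr hr) ((hI hr hs).const_mul 2), integral_const_mul, horth]
          simp
      _ ≤ _ := by
          refine integral_mono_ae ((hI hr hr).add ((hI hr hs).const_mul 2)) (hI hgp hgp) ?_
          filter_upwards [hma] with x hx
          have h0 : 0 ≤ a x * ((q x - p x) * (q x - p x)) :=
            mul_nonneg (hm.trans hx) (mul_self_nonneg _)
          simp only [Pi.sub_apply]
          linarith
  have h1 : m * ∫ x in D, (g x - q x) ^ 2 ≤ ∫ x in D, a x * ((g x - q x) * (g x - q x)) := by
    rw [← integral_const_mul]
    refine integral_mono_ae (hr.integrable_sq.const_mul m) (hI hr hr) ?_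
    filter_upwards [hma] with x hx
    rw [← sq]
    exact mul_le_mul_of_nonneg_right hx (sq_nonneg _)
  have h2 : ∫ x in D, a x * ((g x - p x) * (g x - p x)) ≤ M * ∫ x in D, (g x - p x) ^ 2 := by
    rw [← integral_const_mul]
    refine integral_mono_ae (hI hgp hgp) (hgp.integrable_sq.const_mul M) ?_
    filter_upwards [haM] with x hx
    rw [← sq]
    exact mul_le_mul_of_nonneg_right hx (sq_nonneg _)
  rw [← ofReal_integral_sq hr, ← ofReal_integral_sq hgp, ← ENNReal.ofReal_mul hm,
    ← ENNReal.ofReal_mul hM]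
  exact ENNReal.ofReal_le_ofReal (h1.trans (hmain.trans h2))

/-! ### Approximation of products -/

theorem eLpNorm_weakDeriv_le_sobolevNorm_top {Ω : Set (E d)} {s : ℕ} {u : E d → ℝ}
    {α : Fin d → ℕ} (hα : order α ≤ s) :
    eLpNorm (weakDeriv Ω α u) ∞ (volume.restrict Ω) ≤ sobolevNorm Ω s ∞ u := by
  rw [sobolevNorm, if_pos rfl]
  exact Finset.le_sup (f := fun α => eLpNorm (weakDeriv Ω α u) ∞ (volume.restrict Ω))
    ((mem_multiIndices α).2 hα)

theorem eLpNorm_weakDeriv_le_sobolevNorm_two {Ω : Set (E d)} {s : ℕ} {u : E d → ℝ}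
    {α : Fin d → ℕ} (hα : order α ≤ s) :
    eLpNorm (weakDeriv Ω α u) 2 (volume.restrict Ω) ≤ sobolevNorm Ω s 2 u := by
  rw [sobolevNorm, if_neg (by simp), ENNReal.toReal_ofNat, one_div,
    ENNReal.le_rpow_inv_iff (by norm_num)]
  exact Finset.single_le_sum
    (f := fun α => eLpNorm (weakDeriv Ω α u) 2 (volume.restrict Ω) ^ (2 : ℝ))
    (fun _ _ => zero_le) ((mem_multiIndices α).2 hα)

theorem exists_mem_polySpace_eLpNorm_mul_sub_le {D : Set (E d)} (hD : Convex ℝ D) (hDo : IsOpen D)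
    (hDn : D.Nonempty) (hDb : Bornology.IsBounded D) (N : ℕ) {w u : E d → ℝ}
    (hw : MemSobolev D (N + 1) ∞ w) (hu : MemSobolev D (N + 1) 2 u) :
    ∃ p ∈ polySpace d N, eLpNorm (fun x => u x * w x - p x) 2 (volume.restrict D) ≤
      (2 ^ d * ENNReal.ofReal (Metric.diam D)) ^ (N + 1) *
        (2 ^ (N + 1) * (sobolevNorm D (N + 1) ∞ w * sobolevNorm D (N + 1) 2 u)) := by
  -- The product is formed from the order-zero representatives `weakDeriv D 0`, which agree a.e.
  -- with `u` and `w`.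
  have hex : ∀ α : Fin d → ℕ, ∃ g : E d → ℝ, order α ≤ N + 1 →
      HasWeakDeriv D α (fun x => weakDeriv D 0 u x * weakDeriv D 0 w x) g ∧
      MemLp g 2 (volume.restrict D) ∧ eLpNorm g 2 (volume.restrict D) ≤
        2 ^ order α * (sobolevNorm D (N + 1) ∞ w * sobolevNorm D (N + 1) 2 u) := by
    intro α
    by_cases hα : order α ≤ N + 1
    · obtain ⟨g, hg⟩ := (hu.isDerivFamily hDo).exists_hasWeakDeriv_mul hDo hDb.measure_lt_top.ne
        (hw.isDerivFamily hDo) (fun α hα => eLpNorm_weakDeriv_le_sobolevNorm_two hα)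
        (fun α hα => eLpNorm_weakDeriv_le_sobolevNorm_top hα) (order α) α 0 0 rfl (by simpa)
        (by simpa)
      exact ⟨g, fun _ => hg⟩
    · exact ⟨0, fun h => absurd h hα⟩
  choose F hF using hex
  have hfam : IsDerivFamily D (N + 1) 2 F :=
    { memLp := fun α hα => (hF α hα).2.1
      hasWeakDeriv := fun α i hα => (hF α hα.le).1.single_of_add
        (hF (α + Pi.single i 1) (by rw [order_add, order_single]; exact hα)).1 }
  obtain ⟨p, hp, hpb⟩ := exists_mem_polySpace_eLpNorm_sub_le hD hDo hDn hDb N (N + 1) le_rfl hfam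
    (fun α hα => hα ▸ (hF α hα.le).2.2)
  refine ⟨p, hp, (eLpNorm_congr_ae ?_).trans_le hpb⟩
  have h0 := (hF 0 (by simp)).1
  filter_upwards [h0.ae_eq hDo (hasWeakDeriv_zero h0.1), hu.weakDeriv_zero_ae_eq hDo,
    hw.weakDeriv_zero_ae_eq hDo] with x h1 h2 h3
  rw [h1, h2, h3]

/-- A nonzero measure has a point outside all the exceptional null sets, and there `w · (1/w) = 1`.
-/
theorem one_le_eLpNorm_top_mul_inv {X : Type*} [MeasurableSpace X] {μ : Measure X} (hμ : μ ≠ 0)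
    {w : X → ℝ} (hw : ∀ᵐ x ∂μ, 0 < w x) :
    1 ≤ eLpNorm w ∞ μ * eLpNorm (fun x => 1 / w x) ∞ μ := by
  have : (ae μ).NeBot := ae_neBot.2 hμ
  obtain ⟨x, hx, h1, h2⟩ := (hw.and ((ae_le_eLpNormEssSup (f := w) (μ := μ)).and
    (ae_le_eLpNormEssSup (f := fun x => 1 / w x) (μ := μ)))).exists
  rw [← eLpNorm_exponent_top] at h1 h2
  calc (1 : ℝ≥0∞) = ‖w x‖ₑ * ‖1 / w x‖ₑ := by
        rw [← enorm_mul, mul_one_div_cancel hx.ne', enorm_one]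
    _ ≤ _ := mul_le_mul' h1 h2

theorem ae_le_toReal_eLpNorm_top {X : Type*} [MeasurableSpace X] {μ : Measure X} {f : X → ℝ}
    (hf : MemLp f ∞ μ) : ∀ᵐ x ∂μ, f x ≤ (eLpNorm f ∞ μ).toReal := by
  filter_upwards [ae_le_eLpNormEssSup (f := f) (μ := μ)] with x hx
  rw [← eLpNorm_exponent_top] at hx
  refine (le_abs_self _).trans ?_
  rw [← Real.norm_eq_abs, ← toReal_enorm]
  exact ENNReal.toReal_mono hf.2.ne hx

end WADG

/-! ### The two error estimates. -/

theorem mainTheorem2 (d : ℕ) (hd : 1 ≤ d) (N : ℕ) (σ : ℝ) :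
    ∃ C : ℝ≥0, ∀ D : Set (WADG.E d), WADG.IsAffineElement D → WADG.IsQuasiRegular σ D →
      ∀ h : ℝ, h = Metric.diam D →
      ∀ w u : WADG.E d → ℝ,
        WADG.MemSobolev D (N + 1) ∞ w →
        (∃ wmin : ℝ, 0 < wmin ∧ ∀ᵐ x ∂(volume.restrict D), wmin ≤ w x) →
        WADG.MemSobolev D (N + 1) 2 u →
        ∀ Cw : ℝ≥0∞,
          Cw = C * eLpNorm w ∞ (volume.restrict D) *
            eLpNorm (fun x => 1 / w x) ∞ (volume.restrict D) *
            WADG.sobolevNorm D (N + 1) ∞ w →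
          eLpNorm (fun x => u x * w x - WADG.T D N w u x) 2 (volume.restrict D) ≤
            Cw * ENNReal.ofReal h ^ (N + 1) * WADG.sobolevNorm D (N + 1) 2 u ∧
          eLpNorm (fun x => u x * w x - WADG.TInv D N (fun y => 1 / w y) u x) 2
              (volume.restrict D) ≤
            Cw * ENNReal.ofReal h ^ (N + 1) * WADG.sobolevNorm D (N + 1) 2 u := by
  -- One factor `2 ^ d` for each of the `N + 1` Poincaré steps, and `2 ^ (N + 1)` from the Leibniz
  -- rule.
  refine ⟨(2 ^ d) ^ (N + 1) * 2 ^ (N + 1), ?_⟩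
  rintro D hDaff hDreg _ rfl w u hw ⟨wmin, hwmin, hwminae⟩ hu _ rfl
  have hDo := hDaff.isOpen
  have hDn := hDreg.nonempty
  have hDb := hDaff.isBounded
  have : IsFiniteMeasure (volume.restrict D) := ⟨by simpa using hDb.measure_lt_top⟩
  obtain ⟨p, hp, hpb⟩ :=
    WADG.exists_mem_polySpace_eLpNorm_mul_sub_le hDaff.convex hDo hDn hDb N hw hu
  have hwpos : ∀ᵐ x ∂(volume.restrict D), 0 < w x := by
    filter_upwards [hwminae] with x hx using hwmin.trans_le hx
  have hw' : MemLp (fun x => 1 / w x) ∞ (volume.restrict D) := by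
    refine MemLp.of_bound ?_ (1 / wmin) ?_
    · simp only [one_div]
      exact hw.1.1.aemeasurable.inv.aestronglyMeasurable
    · filter_upwards [hwminae, hwpos] with x hx hx0
      rw [Real.norm_of_nonneg (by positivity)]
      exact one_div_le_one_div_of_le hwmin hx
  have hK1 := WADG.one_le_eLpNorm_top_mul_inv
    (by simpa using (hDo.measure_pos volume hDn).ne') hwpos
  have hwV := WADG.ae_le_toReal_eLpNorm_top hw'
  have hwW := WADG.ae_le_toReal_eLpNorm_top hw.1
  have hWtop : eLpNorm w ∞ (volume.restrict D) ≠ ∞ := hw.1.2.ne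
  have hVtop : eLpNorm (fun x => 1 / w x) ∞ (volume.restrict D) ≠ ∞ := hw'.2.ne
  set W := eLpNorm w ∞ (volume.restrict D)
  set V := eLpNorm (fun x => 1 / w x) ∞ (volume.restrict D)
  have hW0 : W ≠ 0 := by
    intro h0
    simp [h0] at hK1
  have hWpos : 0 < W.toReal := ENNReal.toReal_pos hW0 hWtop
  have huw : MemLp (fun x => u x * w x) 2 (volume.restrict D) := hw.1.mul hu.1
  have hfinal : ∀ q : WADG.E d → ℝ,
      eLpNorm (fun x => u x * w x - q x) 2 (volume.restrict D) ^ 2 ≤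
        W * V * eLpNorm (fun x => u x * w x - p x) 2 (volume.restrict D) ^ 2 →
      eLpNorm (fun x => u x * w x - q x) 2 (volume.restrict D) ≤
        ((2 ^ d) ^ (N + 1) * 2 ^ (N + 1) : ℝ≥0) * W * V * WADG.sobolevNorm D (N + 1) ∞ w *
          ENNReal.ofReal (Metric.diam D) ^ (N + 1) * WADG.sobolevNorm D (N + 1) 2 u := by
    intro q hq
    have hq' : eLpNorm (fun x => u x * w x - q x) 2 (volume.restrict D) ≤
        W * V * eLpNorm (fun x => u x * w x - p x) 2 (volume.restrict D) := by
      rw [← ENNReal.pow_le_pow_left_iff two_ne_zero, mul_pow]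
      refine hq.trans (mul_le_mul_left ?_ _)
      -- Quasi-optimality gives the factor `√(W V)`; it is weakened to `W V`, using `1 ≤ W V`.
      exact le_self_pow₀ hK1 two_ne_zero
    refine hq'.trans ((mul_le_mul_right hpb _).trans_eq ?_)
    push_cast
    ring
  constructor
  · refine hfinal _ ?_
    have hproj : WADG.IsWeightedProj D N (fun _ => 1) (fun x => w x * u x) (WADG.T D N w u) :=
      WADG.isWeightedProj_TInv hDo hDn hDb N (memLp_const 1) one_pos (.of_forall fun _ => le_rfl)
        (by simpa only [mul_comm] using huw)
    have := hproj.eLpNorm_sub_sq_le hDb (memLp_const 1) huw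
      (.of_forall fun x => by simp [mul_comm]) zero_le_one zero_le_one
      (.of_forall fun _ => le_rfl) (.of_forall fun _ => le_rfl) hp
    rw [ENNReal.ofReal_one, one_mul] at this
    exact this.trans (mul_le_mul_left hK1 _)
  · refine hfinal _ ?_
    have hinv : ∀ᵐ x ∂(volume.restrict D), 1 / W.toReal ≤ 1 / w x := by
      filter_upwards [hwW, hwpos] with x hx hx0 using one_div_le_one_div_of_le hx0 hx
    -- Here the weight `1/w` lies between `1/W` and `V`, and the right-hand side is `u = (1/w)(u
    -- w)`.
    have hproj := WADG.isWeightedProj_TInv hDo hDn hDb N hw' (one_div_pos.2 hWpos) hinv hu.1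
    have := hproj.eLpNorm_sub_sq_le hDb hw' huw (by
      filter_upwards [hwpos] with x hx
      field_simp) (one_div_pos.2 hWpos).le ENNReal.toReal_nonneg hinv hwV hp
    rw [one_div, ENNReal.ofReal_inv_of_pos hWpos, ENNReal.ofReal_toReal hWtop,
      ENNReal.ofReal_toReal hVtop] at this
    calc _ = W * (W⁻¹ * eLpNorm (fun x => u x * w x - WADG.TInv D N (fun y => 1 / w y) u x) 2
          (volume.restrict D) ^ 2) := by
          rw [← mul_assoc, ENNReal.mul_inv_cancel hW0 hWtop, one_mul]
      _ ≤ _ := by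
          rw [mul_assoc W V]
          exact mul_le_mul_right this W
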